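/- Conventions. Let $\dot A$ be a closed, densely defined symmetric operator with equal finite deficiency indices in a complex Hilbert space $\mathcal H$, let $\mathcal H_+=\mathrm{dom}(\dot A^*)$ with $(f,g)_+=(f,g)+(\dot A^*f,\dot A^*g)$, and let $\mathcal H_+\subset\mathcal H\subset\mathcal H_-$ be the corresponding rigged Hilbert space. A scattering L-system $\Theta$ with input-output space $\mathbb C$ consists of such an $\dot A$, a non-symmetric operator $T$ with $\dot A\subset T\subset\dot A^*$, $\rho(T)\neq\emptyset$ and $\mathrm{dom}(\dot A)=\mathrm{dom}(T)\cap\mathrm{dom}(T^*)$, a bounded operator $\mathbb A:\mathcal H_+\to\mathcal H_-$ with $\mathbb A\supset T$, $\mathbb A^*\supset T^*$, such that $\mathrm{Re}\,\mathbb A\supset\dot A$ and the restriction $\hat A$ of $\mathrm{Re}\,\mathbb A$ to $\{f\in\mathcal H_+:(\mathrm{Re}\,\mathbb A)f\in\mathcal H\}$ is self-adjoint in $\mathcal H$, and a bounded operator $K:\mathbb C\to\mathcal H_-$ with $\mathrm{Im}\,\mathbb A=KK^*$ and $\mathrm{ran}\,K=\mathrm{ran}\,\mathrm{Im}\,\mathbb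 A$. Its transfer and impedance functions are $$W_\Theta(z)=1-2iK^*(\mathbb A-zI)^{-1}K\ (z\in\rho(T)),\qquad V_\Theta(z)=K^*(\mathrm{Re}\,\mathbb A-zI)^{-1}K\ (z\in\rho(\hat A)).$$ For $\alpha\in[0,\pi)$, an L-system $\Theta_\alpha$ of this kind is a unimodular transformation of $\Theta$ if $W_{\Theta_\alpha}(z)=W_\Theta(z)\cdot(-e^{2i\alpha})$ wherever both sides are defined; it is non-trivial if $\alpha\neq\pi/2$. For $0\le\kappa<1$ and $Q\in\mathbb R$ let $\mathfrak M^Q_\kappa$ be the class of analytic functions $V$ from the open upper half-plane $\mathbb C_+$ into itself of the form $$V(z)=Q+\int_{\mathbb R}\Big(\frac1{\lambda-z}-\frac{\lambda}{1+\lambda^2}\Big)d\mu(\lambda),\qquad \int_{\mathbb R}\frac{d\mu(\lambda)}{1+\lambda^2}=\frac{1-\kappa}{1+\kappa},$$ with $\mu$ an infinite Borel measure on $\mathbb R$. Theorem. Let $0\le\kappa<1$, let $Q\in\mathbb R$ with $Q\neq0$, and let $\Theta$ be a scattering L-system with input-output space $\mathbb C$ whose impedance function $V_\Theta$ belongs to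 $\mathfrak M^Q_\kappa$. Let $\Theta_\alpha$ be a non-trivial ($\alpha\in[0,\pi)$, $\alpha\ne\pi/2$) unimodular transformation of $\Theta$. Then $V_{\Theta_\alpha}\in\mathfrak M^{-Q}_\kappa$ if and only if $$\tan\alpha=\frac{b}{2Q},\qquad\text{where } b=Q^2+a^2-1,\quad a=\frac{1-\kappa}{1+\kappa}.$$ -/

import Mathlib

open MeasureTheory Set
open scoped InnerProductSpace ComplexConjugate

noncomputable section

namespace LSys

variable {H : Type*} [NormedAddCommGroup H] [InnerProductSpace ℂ H] [CompleteSpace H]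

/-! Mathlib's inner product `⟪x, y⟫_ℂ` is linear in `y`; the pairing `(x, y)` that is linear in
`x` is therefore `⟪y, x⟫_ℂ`. In the comments `A` is the symmetric operator and `A*` its adjoint. -/

/-- The space `H₊ = dom A*` with inner product `(f, g)₊ = (f, g) + (A* f, A* g)`, realized as the
graph of `A*` inside the Hilbert space direct sum `H ⊕ H`. -/
def plusSubmodule (A : H →ₗ.[ℂ] H) : Submodule ℂ (WithLp 2 (H × H)) :=
  A.adjoint.graph.comap (WithLp.linearEquiv 2 ℂ (H × H)).toLinearMap

/-- The Hilbert space `H₊`. -/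
def HPlus (A : H →ₗ.[ℂ] H) : Type _ := plusSubmodule A

instance (A : H →ₗ.[ℂ] H) : NormedAddCommGroup (HPlus A) :=
  inferInstanceAs (NormedAddCommGroup (plusSubmodule A))

instance (A : H →ₗ.[ℂ] H) : InnerProductSpace ℂ (HPlus A) :=
  inferInstanceAs (InnerProductSpace ℂ (plusSubmodule A))

/-- The space `H₋` dual to `H₊`: bounded antilinear functionals `g` on `H₊`, where
`g f` is the pairing `(g, f)`. -/
abbrev HMinus (A : H →ₗ.[ℂ] H) : Type _ := HPlus A →L⋆[ℂ] ℂ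

/-- The inclusion `H₊ ⊂ H`. -/
def incl (A : H →ₗ.[ℂ] H) : HPlus A →L[ℂ] H :=
  (WithLp.fstL 2 ℂ H H).comp (plusSubmodule A).subtypeL

/-- The inclusion `H ⊂ H₋`: the vector `h` is the functional `f ↦ (h, f)`. -/
def toMinus (A : H →ₗ.[ℂ] H) (h : H) : HMinus A :=
  ((innerSL ℂ).flip h).comp (incl A)

theorem toMinus_apply (A : H →ₗ.[ℂ] H) (h : H) (f : HPlus A) :
    toMinus A h f = ⟪incl A f, h⟫_ℂ := rfl

/-- The adjoint `𝔸* ∈ [H₊, H₋]` of `𝔸 ∈ [H₊, H₋]`: `(𝔸* g, f)` is the conjugate of `(𝔸 f, g)`. -/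
def biAdjoint {A : H →ₗ.[ℂ] H} (S : HPlus A →L[ℂ] HMinus A) : HPlus A →L[ℂ] HMinus A :=
  LinearMap.mkContinuous₂
    (LinearMap.mk₂'ₛₗ (RingHom.id ℂ) (starRingEnd ℂ) (fun g f => conj (S f g))
      (by intro g₁ g₂ f; simp) (by intro c g f; simp)
      (by intro g f₁ f₂; simp) (by intro c g f; simp))
    ‖S‖
    (by
      intro g f
      have h := S.le_opNorm₂ f g
      simp only [LinearMap.mk₂'ₛₗ_apply, RCLike.norm_conj]
      linarith [mul_right_comm ‖S‖ ‖f‖ ‖g‖])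

theorem biAdjoint_apply {A : H →ₗ.[ℂ] H} (S : HPlus A →L[ℂ] HMinus A) (g f : HPlus A) :
    biAdjoint S g f = conj (S f g) := rfl

/-- `Re 𝔸 = (𝔸 + 𝔸*) / 2`. -/
def biRe {A : H →ₗ.[ℂ] H} (S : HPlus A →L[ℂ] HMinus A) : HPlus A →L[ℂ] HMinus A :=
  (1 / 2 : ℂ) • (S + biAdjoint S)

/-- `Im 𝔸 = (𝔸 - 𝔸*) / (2i)`. -/
def biIm {A : H →ₗ.[ℂ] H} (S : HPlus A →L[ℂ] HMinus A) : HPlus A →L[ℂ] HMinus A :=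
  (1 / (2 * Complex.I) : ℂ) • (S - biAdjoint S)

/-- `𝔸 ⊃ T` for `𝔸 ∈ [H₊, H₋]` and an operator `T` in `H`. -/
def Extends {A : H →ₗ.[ℂ] H} (S : HPlus A →L[ℂ] HMinus A) (T : H →ₗ.[ℂ] H) : Prop :=
  ∀ x : T.domain, ∃ f : HPlus A, incl A f = x ∧ S f = toMinus A (T x)

/-- The graph of the quasi-kernel: pairs `(f, 𝔸 f)` with `f ∈ H₊` and `𝔸 f ∈ H`. -/
def quasiKernelGraph {A : H →ₗ.[ℂ] H} (S : HPlus A →L[ℂ] HMinus A) : Submodule ℂ (H × H) where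
  carrier := {p | ∃ f : HPlus A, incl A f = p.1 ∧ S f = toMinus A p.2}
  add_mem' := by
    rintro p q ⟨f, hf, hf'⟩ ⟨g, hg, hg'⟩
    refine ⟨f + g, by simp [hf, hg], ?_⟩
    rw [map_add, hf', hg']
    ext u
    simp [toMinus_apply]
  zero_mem' := ⟨0, by simp, by ext u; simp [toMinus_apply]⟩
  smul_mem' := by
    rintro c p ⟨f, hf, hf'⟩
    refine ⟨c • f, by simp [hf], ?_⟩
    rw [map_smul, hf']
    ext u
    simp [toMinus_apply]

/-- The quasi-kernel of `𝔸`: its restriction to `{f ∈ H₊ | 𝔸 f ∈ H}`, an operator in `H`. -/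
def quasiKernel {A : H →ₗ.[ℂ] H} (S : HPlus A →L[ℂ] HMinus A) : H →ₗ.[ℂ] H :=
  (quasiKernelGraph S).toLinearPMap

/-- `𝔸` is a t-self-adjoint bi-extension of `A`: `𝔸 = 𝔸*`, `𝔸 ⊃ A`, and the quasi-kernel is a
self-adjoint operator in `H`. -/
structure IsTSelfAdjointBiExtension {A : H →ₗ.[ℂ] H} (S : HPlus A →L[ℂ] HMinus A) : Prop where
  selfAdjoint : biAdjoint S = S
  ext : Extends S A
  quasiKernel_selfAdjoint : IsSelfAdjoint (quasiKernel S)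

/-- The resolvent set `ρ(T)` of an operator in `H`: `T - z` is a bijection of `dom T` onto `H`
with bounded inverse `R`. -/
def resolventSet (T : H →ₗ.[ℂ] H) : Set ℂ :=
  {z | ∃ R : H →L[ℂ] H,
    (∀ h : H, ∃ x : T.domain, (x : H) = R h ∧ T x - z • (x : H) = h) ∧
    ∀ x : T.domain, R (T x - z • (x : H)) = x}

/-- The subspace `Ker (A* - z)`. -/
def deficiencySubspace (A : H →ₗ.[ℂ] H) (z : ℂ) : Submodule ℂ H :=
  A.adjoint.graph.comap (LinearMap.prod LinearMap.id (z • LinearMap.id))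

/-- A closed densely defined symmetric operator with equal finite deficiency indices. -/
structure IsAdmissible (A : H →ₗ.[ℂ] H) : Prop where
  closed : A.IsClosed
  dense : Dense (A.domain : Set H)
  symmetric : A.IsFormalAdjoint A
  finite_pos : FiniteDimensional ℂ (deficiencySubspace A Complex.I)
  finite_neg : FiniteDimensional ℂ (deficiencySubspace A (-Complex.I))
  equal : Module.finrank ℂ (deficiencySubspace A Complex.I) =
    Module.finrank ℂ (deficiencySubspace A (-Complex.I))

/-- The class `Λ(A)`: non-symmetric operators `T` with `A ⊂ T ⊂ A*`, `ρ(T) ≠ ∅` and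
`dom A = dom T ∩ dom T*`. -/
structure IsLambda (A T : H →ₗ.[ℂ] H) : Prop where
  le : A ≤ T
  le_adjoint : T ≤ A.adjoint
  not_symmetric : ¬ T.IsFormalAdjoint T
  resolvent_nonempty : (resolventSet T).Nonempty
  domain_eq : A.domain = T.domain ⊓ T.adjoint.domain

/-- `𝔸` is a (∗)-extension of `T`: `𝔸 ⊃ T ⊃ A`, `𝔸* ⊃ T* ⊃ A`, and `Re 𝔸` is a t-self-adjoint
bi-extension of `A`. -/
structure IsStarExtension {A : H →ₗ.[ℂ] H} (T : H →ₗ.[ℂ] H)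
    (S : HPlus A →L[ℂ] HMinus A) : Prop where
  le : A ≤ T
  le_adjoint : A ≤ T.adjoint
  ext : Extends S T
  ext_adjoint : Extends (biAdjoint S) T.adjoint
  re : IsTSelfAdjointBiExtension (biRe S)

/-- The adjoint `K* : H₊ → ℂ` of a channel operator `K : ℂ → H₋`, given by
`(K c, f) = c · conj (K* f)`. -/
def channelAdjoint {A : H →ₗ.[ℂ] H} (K : ℂ →L[ℂ] HMinus A) (f : HPlus A) : ℂ :=
  conj (K 1 f)

theorem channelAdjoint_spec {A : H →ₗ.[ℂ] H} (K : ℂ →L[ℂ] HMinus A) (c : ℂ) (f : HPlus A) :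
    K c f = c * conj (channelAdjoint K f) := by
  have h : K c = c • K 1 := by rw [← map_smul]; simp
  simp [h, channelAdjoint]

/-- `(𝔸 - z I)⁻¹ y` for `y ∈ H₋`: the element `x ∈ H₊` with `𝔸 x - z x = y` in `H₋`
(used where `𝔸 - z I` is injective and `y` lies in its range). -/
def biResolvent {A : H →ₗ.[ℂ] H} (S : HPlus A →L[ℂ] HMinus A) (z : ℂ) (y : HMinus A) : HPlus A :=
  Function.invFun (fun x : HPlus A => S x - z • toMinus A (incl A x)) y

/-- A scattering L-system with input-output space `ℂ` (so that the direction operator is `1`) and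
state space `H`. -/
structure LSystem (H : Type*) [NormedAddCommGroup H] [InnerProductSpace ℂ H]
    [CompleteSpace H] where
  /-- the symmetric operator -/
  A : H →ₗ.[ℂ] H
  /-- the main operator -/
  T : H →ₗ.[ℂ] H
  /-- the state-space operator -/
  S : HPlus A →L[ℂ] HMinus A
  /-- the channel operator -/
  K : ℂ →L[ℂ] HMinus A
  admissible : IsAdmissible A
  lambda : IsLambda A T
  starExtension : IsStarExtension T S
  im_eq : ∀ f : HPlus A, biIm S f = K (channelAdjoint K f)
  range_eq : Set.range K = Set.range (biIm S)

/-- The transfer function `W(z) = 1 - 2i K* (𝔸 - z I)⁻¹ K`, `z ∈ ρ(T)`. -/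
def LSystem.transfer (Θ : LSystem H) (z : ℂ) : ℂ :=
  1 - 2 * Complex.I * channelAdjoint Θ.K (biResolvent Θ.S z (Θ.K 1))

/-- The impedance function `V(z) = K* (Re 𝔸 - z I)⁻¹ K`; it is only evaluated off the real axis,
that is inside the resolvent set of the self-adjoint quasi-kernel of `Re 𝔸`. -/
def LSystem.impedance (Θ : LSystem H) (z : ℂ) : ℂ :=
  channelAdjoint Θ.K (biResolvent (biRe Θ.S) z (Θ.K 1))

/-- `Θ'` is the unimodular transformation of `Θ` with angle `α ∈ [0, π)`: the transfer functions
satisfy `W_Θ' = W_Θ · (-e^{2iα})` where both are defined. -/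
def IsUnimodularTransformation {H' : Type*} [NormedAddCommGroup H'] [InnerProductSpace ℂ H']
    [CompleteSpace H'] (Θ : LSystem H) (Θ' : LSystem H') (α : ℝ) : Prop :=
  α ∈ Set.Ico 0 Real.pi ∧
    ∀ z ∈ resolventSet Θ.T ∩ resolventSet Θ'.T,
      Θ'.transfer z = Θ.transfer z * (-Complex.exp (2 * Complex.I * α))

/-- The perturbed generalized Donoghue class with parameters `κ`, `Q`: analytic maps `V` of the
open upper half-plane into itself of the form
`V(z) = Q + ∫ (1 / (t - z) - t / (1 + t²)) dμ(t)` with an infinite Borel measure `μ` such that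
`∫ dμ(t) / (1 + t²) = (1 - κ) / (1 + κ)`. Only the values of `V` in the upper half-plane matter. -/
def DonoghueClass (κ Q : ℝ) (V : ℂ → ℂ) : Prop :=
  DifferentiableOn ℂ V {z | 0 < z.im} ∧
  MapsTo V {z | 0 < z.im} {z | 0 < z.im} ∧
  ∃ μ : Measure ℝ, μ Set.univ = ⊤ ∧
    Integrable (fun t : ℝ => 1 / (1 + t ^ 2)) μ ∧
    ∫ t : ℝ, 1 / (1 + t ^ 2) ∂μ = (1 - κ) / (1 + κ) ∧
    ∀ z : ℂ, 0 < z.im →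
      V z = Q + ∫ t : ℝ, (1 / ((t : ℂ) - z) - (t : ℂ) / (1 + (t : ℂ) ^ 2)) ∂μ

end LSys

end

/-! On the lower half-plane `W = (1 - iV) / (1 + iV)`, so multiplying `W` by `-e^{2iα}` rotates the
impedance: with `c = cos α`, `s = sin α`, the new one is `(c + sV) / (s - cV)`. Symmetry under
conjugation carries this to the upper half-plane. Every `V` of the class satisfies `V(i) = Q + ia`.
Requiring `V_α(i) = -Q + ia` is one complex equation; its imaginary part holds identically and its
real part is `2sQ = c(Q² + a² - 1)`, which is the tangent condition because `c ≠ 0`. This gives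
necessity (`LSys.DonoghueClass.neg_iff_of_moebius`).

For sufficiency the value at `i` must already force membership (`LSys.DonoghueClass.of_moebius`).
The rotated function has a Nevanlinna representation, derived here from the Herglotz theorem on the
disc. It remains to see that the linear term vanishes and that the measure is infinite. Both follow
from comparing imaginary parts along `z = in`, where `n · Im V(in)` tends to the total mass of the
measure of `V`, here infinite.

The operator part must show that the transfer relation is available at all, since it is assumed only
on `ρ(T) ∩ ρ(T_α)`. `T` is dissipative and extends `A` by one dimension, as does the self-adjoint
quasi-kernel of `Re 𝔸`. Comparing the two extensions shows that the whole lower half-plane lies in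
`ρ(T)` (`LSys.LSystem.mem_resolventSet_of_im_neg`). -/

/-! ### Herglotz representation on the unit disc. -/

open Metric Filter Topology Real in
/-- The measure on the unit circle with continuous density `u` against normalized arc length. -/
theorem exists_finiteMeasure_sphere_circleAverage {u : ℂ → ℝ}
    (hu : ContinuousOn u (sphere 0 1)) (hu0 : ∀ z ∈ sphere (0 : ℂ) 1, 0 ≤ u z) :
    ∃ ν : FiniteMeasure (sphere (0 : ℂ) 1), ν.mass = (circleAverage u 0 1).toNNReal ∧
      ∀ h : ℂ → ℂ, ContinuousOn h (sphere 0 1) →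
        ∫ ζ, h (ζ : ℂ) ∂(ν : Measure (sphere (0 : ℂ) 1)) =
          circleAverage (fun z => u z • h z) 0 1 := by
  have hmem : ∀ θ : ℝ, circleMap 0 1 θ ∈ sphere (0 : ℂ) 1 := fun θ =>
    circleMap_mem_sphere 0 zero_le_one θ
  set g : ℝ → sphere (0 : ℂ) 1 := fun θ => ⟨circleMap 0 1 θ, hmem θ⟩ with hg
  have hgc : Continuous g := (continuous_circleMap 0 1).subtype_mk _
  have hpi : 0 < (2 * π)⁻¹ := by positivity
  set d : ℝ → ℝ := fun θ => (2 * π)⁻¹ * u (circleMap 0 1 θ) with hd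
  have hdc : Continuous d := by
    refine continuous_const.mul ?_
    exact hu.comp_continuous (continuous_circleMap 0 1) hmem
  have hd0 : ∀ θ, 0 ≤ d θ := fun θ => mul_nonneg hpi.le (hu0 _ (hmem θ))
  set m : Measure ℝ := volume.restrict (Ioc 0 (2 * π)) with hm
  have hint : Integrable d m :=
    (hdc.continuousOn.integrableOn_Icc (a := 0) (b := 2 * π)).mono_set Ioc_subset_Icc_self
  have hpi2 : (0 : ℝ) ≤ 2 * π := by positivity
  have hdint : ∫ θ, d θ ∂m = circleAverage u 0 1 := by
    rw [circleAverage_def, intervalIntegral.integral_of_le hpi2, ← integral_smul]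
    rfl
  set n : Measure ℝ := m.withDensity (fun θ => ((d θ).toNNReal : ENNReal)) with hn
  have hnuniv : n univ = ENNReal.ofReal (circleAverage u 0 1) := by
    rw [hn, withDensity_apply _ MeasurableSet.univ, Measure.restrict_univ, ← hdint,
      ofReal_integral_eq_lintegral_ofReal hint (Filter.Eventually.of_forall hd0)]
    rfl
  have hfin : IsFiniteMeasure n := ⟨by rw [hnuniv]; exact ENNReal.ofReal_lt_top⟩
  have hfin' : IsFiniteMeasure (n.map g) := Measure.isFiniteMeasure_map n g
  refine ⟨⟨n.map g, hfin'⟩, ?_, ?_⟩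
  · have : (n.map g) univ = ENNReal.ofReal (circleAverage u 0 1) := by
      rw [Measure.map_apply hgc.measurable MeasurableSet.univ, preimage_univ, hnuniv]
    exact congrArg ENNReal.toNNReal this
  · intro h hh
    have hhc : Continuous (fun ζ : sphere (0 : ℂ) 1 => h ζ) := continuousOn_iff_continuous_domRestrict.1 hh
    rw [FiniteMeasure.toMeasure_mk, integral_map hgc.aemeasurable hhc.aestronglyMeasurable, hn,
      integral_withDensity_eq_integral_smul hdc.measurable.real_toNNReal, circleAverage_def,
      intervalIntegral.integral_of_le hpi2, ← integral_smul]
    refine integral_congr_ae (Filter.Eventually.of_forall fun θ => ?_)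
    change ((d θ).toNNReal : ℝ) • h (circleMap 0 1 θ) = _
    rw [Real.coe_toNNReal _ (hd0 θ), hd, mul_smul]

open Metric Real in
/-- **Schwarz integral formula** on the unit disc. -/
theorem circleAverage_re_smul_of_diffContOnCl {F : ℂ → ℂ} (hF : DiffContOnCl ℂ F (ball 0 1))
    {w : ℂ} (hw : w ∈ ball (0 : ℂ) 1) :
    circleAverage (fun z => (F z).re • ((z + w) / (z - w))) 0 1 = F w - Complex.I * (F 0).im := by
  have hcont : ContinuousOn F (sphere 0 1) :=
    hF.2.mono (sphere_subset_closedBall.trans_eq (closure_ball 0 one_ne_zero).symm)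
  have hw' : ‖w‖ < 1 := by simpa using hw
  have hne : ∀ z ∈ sphere (0 : ℂ) 1, z - w ≠ 0 := by
    intro z hz h
    rw [sub_eq_zero.1 h] at hz
    simp only [mem_sphere_iff_norm, sub_zero] at hz
    linarith
  have hne' : ∀ z ∈ closedBall (0 : ℂ) 1, 1 - conj w * z ≠ 0 := by
    intro z hz h
    have h1 : ‖conj w * z‖ < 1 := by
      rw [norm_mul, RCLike.norm_conj]
      have : ‖z‖ ≤ 1 := by simpa using hz
      nlinarith [norm_nonneg z, norm_nonneg w]
    rw [← sub_eq_zero.1 h] at h1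
    simp at h1
  have hball1 : ball (0 : ℂ) |1| = ball 0 1 := by simp
  have h1 : circleAverage (fun z => (z / (z - w)) • F z) 0 1 = F w := by
    have := DiffContOnCl.circleAverage_smul_div (f := F) (c := 0) (R := 1) (w := w)
      (by rwa [hball1]) (by rwa [hball1])
    simpa using this
  have h0 : circleAverage F 0 1 = F 0 :=
    DiffContOnCl.circleAverage (by rwa [hball1])
  -- On the circle this kernel is the conjugate of `(z + w) / (z - w)`, and it is holomorphic in the
  -- disc with value 1 at 0. It handles the `conj F` half of `Re F`.
  have h2 : circleAverage (fun z => ((1 + conj w * z) / (1 - conj w * z)) • F z) 0 1 = F 0 := by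
    have : DiffContOnCl ℂ (fun z => ((1 + conj w * z) / (1 - conj w * z)) • F z)
        (ball 0 |1|) := by
      rw [hball1]
      refine DiffContOnCl.smul (DifferentiableOn.diffContOnCl ?_) hF
      rw [closure_ball 0 one_ne_zero]
      exact DifferentiableOn.div (by fun_prop) (by fun_prop) hne'
    rw [this.circleAverage]
    simp
  have hs : ∀ z ∈ sphere (0 : ℂ) 1, 1 - conj w * z ≠ 0 := fun z hz =>
    hne' z (sphere_subset_closedBall hz)
  have key : circleAverage (fun z => (F z).re • ((z + w) / (z - w))) 0 1 =
      circleAverage (fun z => (z / (z - w)) • F z) 0 1 - (1 / 2 : ℂ) • circleAverage F 0 1 +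
      (1 / 2 : ℂ) • conj (circleAverage
        (fun z => ((1 + conj w * z) / (1 - conj w * z)) • F z) 0 1) := by
    have hi1 : CircleIntegrable (fun z => (z / (z - w)) • F z) 0 1 :=
      ContinuousOn.circleIntegrable zero_le_one
        ((ContinuousOn.div (by fun_prop) (by fun_prop) hne).smul hcont)
    have hi0 : CircleIntegrable F 0 1 := hcont.circleIntegrable zero_le_one
    have hi2 : CircleIntegrable (fun z => ((1 + conj w * z) / (1 - conj w * z)) • F z) 0 1 :=
      ContinuousOn.circleIntegrable zero_le_one
        ((ContinuousOn.div (by fun_prop) (by fun_prop) hs).smul hcont)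
    have hi3 : CircleIntegrable
        (fun z => conj (((1 + conj w * z) / (1 - conj w * z)) • F z)) 0 1 :=
      ContinuousOn.circleIntegrable zero_le_one (continuous_star.comp_continuousOn
        ((ContinuousOn.div (by fun_prop) (by fun_prop) hs).smul hcont))
    have hc : conj (circleAverage
        (fun z => ((1 + conj w * z) / (1 - conj w * z)) • F z) 0 1) = circleAverage
        (fun z => conj (((1 + conj w * z) / (1 - conj w * z)) • F z)) 0 1 := by
      have := (Complex.conjCLE : ℂ →L[ℝ] ℂ).circleAverage_comp_comm hi2
      exact this.symm
    rw [hc, ← circleAverage_fun_smul, ← circleAverage_fun_smul, ← circleAverage_fun_sub hi1,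
      ← circleAverage_fun_add]
    · refine circleAverage_congr_sphere fun z hz => ?_
      have hz' : z ∈ sphere (0 : ℂ) 1 := by simpa using hz
      have hzz : z * conj z = 1 := by
        rw [Complex.mul_conj, Complex.normSq_eq_norm_sq]
        have : ‖z‖ = 1 := by simpa using hz'
        simp [this]
      have hz0 : z ≠ 0 := by rintro rfl; simp at hzz
      have hcz : conj z = z⁻¹ := eq_inv_of_mul_eq_one_right hzz
      have hd := hne z hz'
      simp only [smul_eq_mul, map_mul, map_div₀, map_add, map_sub, map_one, Complex.conj_conj,
        Complex.real_smul, hcz, Complex.re_eq_add_conj]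
      have hd' : 1 - w * z⁻¹ ≠ 0 := by
        intro h
        apply hd
        field_simp at h
        simpa using h
      field_simp
      ring
    · exact hi1.sub (hi0.const_smul)
    · exact hi3.const_smul
    · exact hi0.const_smul
  rw [key, h1, h0, h2]
  have : conj (F 0) = F 0 - 2 * Complex.I * (F 0).im := by
    apply Complex.ext <;> simp; ring
  rw [this]
  simp only [smul_eq_mul]
  ring

open Metric Filter Topology Real in
/-- **Herglotz representation** of a holomorphic function on the unit disc whose real part is
nonnegative. -/
theorem exists_finiteMeasure_sphere_herglotz {F : ℂ → ℂ} (hF : DifferentiableOn ℂ F (ball 0 1))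
    (hF0 : ∀ w ∈ ball (0 : ℂ) 1, 0 ≤ (F w).re) :
    ∃ ν : FiniteMeasure (sphere (0 : ℂ) 1), ∀ w ∈ ball (0 : ℂ) 1,
      F w = Complex.I * (F 0).im +
        ∫ ζ, ((ζ : ℂ) + w) / ((ζ : ℂ) - w) ∂(ν : Measure (sphere (0 : ℂ) 1)) := by
  have hr : ∀ r ∈ Ioo (0 : ℝ) 1, ∃ ν : FiniteMeasure (sphere (0 : ℂ) 1),
      ν.mass = (F 0).re.toNNReal ∧ ∀ w ∈ ball (0 : ℂ) 1,
        ∫ ζ, ((ζ : ℂ) + w) / ((ζ : ℂ) - w) ∂(ν : Measure (sphere (0 : ℂ) 1)) =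
          F (r * w) - Complex.I * (F 0).im := by
    rintro r ⟨hr0, hr1⟩
    have hmaps : MapsTo (fun w : ℂ => (r : ℂ) * w) (closedBall 0 1) (ball 0 1) := by
      intro w hw
      have : ‖w‖ ≤ 1 := by simpa using hw
      simp only [mem_ball_zero_iff, norm_mul, Complex.norm_real, norm_eq_abs, abs_of_pos hr0]
      nlinarith
    have hdiff : DifferentiableOn ℂ (fun w => F (r * w)) (closedBall 0 1) :=
      hF.comp (by fun_prop) hmaps
    have hdc : DiffContOnCl ℂ (fun w => F (r * w)) (ball 0 1) := by
      apply DifferentiableOn.diffContOnCl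
      rwa [closure_ball 0 one_ne_zero]
    obtain ⟨ν, hν, hν'⟩ := exists_finiteMeasure_sphere_circleAverage
      (u := fun z => (F (r * z)).re)
      (Complex.continuous_re.comp_continuousOn (hdiff.continuousOn.mono sphere_subset_closedBall))
      (fun z hz => hF0 _ (hmaps (sphere_subset_closedBall hz)))
    refine ⟨ν, ?_, fun w hw => ?_⟩
    · rw [hν]
      congr 1
      -- The case `w = 0` computes the mass as `Re F(0)`. It does not depend on `r`, so all these
      -- measures lie in one compact set.
      have h := circleAverage_re_smul_of_diffContOnCl hdc (w := 0) (by simp)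
      have h2 : circleAverage (fun z => (F (r * z)).re • ((z + 0) / (z - 0))) 0 1 =
          ((circleAverage (fun z => (F (r * z)).re) 0 1 : ℝ) : ℂ) := by
        rw [circleAverage_congr_sphere (f₂ := fun z => (((F (r * z)).re : ℝ) : ℂ))]
        · simp only [circleAverage_def, intervalIntegral.integral_ofReal, Complex.real_smul,
            smul_eq_mul, Complex.ofReal_mul]
        · intro z hz
          have hz0 : z ≠ 0 := by rintro rfl; simp at hz
          simp [hz0]
      rw [h2] at h
      have h3 := congrArg Complex.re h
      simpa using h3
    · rw [hν' (fun ζ => (ζ + w) / (ζ - w))]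
      · have := circleAverage_re_smul_of_diffContOnCl hdc hw
        simpa using this
      · refine ContinuousOn.div (by fun_prop) (by fun_prop) ?_
        intro z hz h
        rw [sub_eq_zero.1 h] at hz
        simp at hz hw
        linarith
  choose! ν hmass hint using hr
  have hcpt := isCompact_setOfPred_finiteMeasure_eq_of_compactSpace (sphere (0 : ℂ) 1)
    (F 0).re.toNNReal
  have hev : ∀ᶠ r in 𝓝[<] (1 : ℝ), r ∈ Ioo (0 : ℝ) 1 := Ioo_mem_nhdsLT one_pos
  -- An ultrafilter finer than `r → 1⁻` replaces the extraction of a weakly convergent subsequence.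
  let U : Ultrafilter ℝ := Ultrafilter.of (𝓝[<] (1 : ℝ))
  have hU : (U : Filter ℝ) ≤ 𝓝[<] (1 : ℝ) := Ultrafilter.of_le _
  obtain ⟨ν₀, -, hν₀⟩ := isCompact_iff_ultrafilter_le_nhds'.1 hcpt (U.map ν) (by
    change ∀ᶠ r in (U : Filter ℝ), (ν r).mass = _
    exact (hev.filter_mono hU).mono fun r hr => hmass r hr)
  have ht : Tendsto ν U (𝓝 ν₀) := hν₀
  refine ⟨ν₀, fun w hw => ?_⟩
  have hcont : Continuous (fun ζ : sphere (0 : ℂ) 1 => ((ζ : ℂ) + w) / ((ζ : ℂ) - w)) := by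
    refine Continuous.div (by fun_prop) (by fun_prop) ?_
    rintro ⟨z, hz⟩ h
    simp only [sub_eq_zero] at h
    rw [h] at hz
    simp at hz hw
    linarith
  have h1 := (FiniteMeasure.tendsto_iff_forall_integral_rclike_tendsto ℂ).1 ht
    (BoundedContinuousFunction.mkOfCompact ⟨_, hcont⟩)
  simp only [BoundedContinuousFunction.mkOfCompact_apply, ContinuousMap.coe_mk] at h1
  have h2 : Tendsto (fun r : ℝ => F (r * w) - Complex.I * (F 0).im) U
      (𝓝 (F w - Complex.I * (F 0).im)) := by
    refine Tendsto.sub_const ?_ _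
    have hc : ContinuousAt F w := (hF.differentiableAt (isOpen_ball.mem_nhds hw)).continuousAt
    refine hc.tendsto.comp ?_
    have : Tendsto (fun r : ℝ => (r : ℂ) * w) (𝓝 1) (𝓝 (((1 : ℝ) : ℂ) * w)) := by
      apply Continuous.tendsto
      fun_prop
    rw [Complex.ofReal_one, one_mul] at this
    exact this.mono_left (hU.trans nhdsWithin_le_nhds)
  have h3 := tendsto_nhds_unique (h1.congr' ((hev.filter_mono hU).mono fun r hr => hint r hr w hw)) h2
  rw [h3]
  ring

/-! ### Nevanlinna representation on the upper half-plane. -/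

theorem Complex.mul_sub_inv_kernel {t z : ℂ} (h : t - z ≠ 0) (h' : 1 + t ^ 2 ≠ 0) :
    (1 + t ^ 2) * (1 / (t - z) - t / (1 + t ^ 2)) = (1 + t * z) / (t - z) := by
  field_simp
  ring

theorem Complex.one_add_ofReal_sq_ne_zero (t : ℝ) : (1 : ℂ) + (t : ℂ) ^ 2 ≠ 0 := by
  have : (0 : ℝ) < 1 + t ^ 2 := by positivity
  exact_mod_cast this.ne'

theorem Complex.ofReal_sub_ne_zero_of_im {z : ℂ} (hz : z.im ≠ 0) (t : ℝ) : (t : ℂ) - z ≠ 0 := by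
  intro h
  apply hz
  rw [← sub_eq_zero.1 h]
  simp

open Metric in
/-- **Nevanlinna representation** of a holomorphic function on the upper half-plane whose imaginary
part is nonnegative. -/
theorem exists_measure_nevanlinna {V : ℂ → ℂ} (hV : DifferentiableOn ℂ V {z | 0 < z.im})
    (hV0 : ∀ z : ℂ, 0 < z.im → 0 ≤ (V z).im) :
    ∃ (L : ℝ) (μ : Measure ℝ), 0 ≤ L ∧ Integrable (fun t : ℝ => 1 / (1 + t ^ 2)) μ ∧
      ∀ z : ℂ, 0 < z.im → V z = (V Complex.I).re + L * z +
        ∫ t : ℝ, (1 / ((t : ℂ) - z) - (t : ℂ) / (1 + (t : ℂ) ^ 2)) ∂μ := by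
  have hI2 : Complex.I ^ 2 = -1 := Complex.I_sq
  have hne1 : ∀ w ∈ ball (0 : ℂ) 1, 1 - w ≠ 0 := by
    intro w hw h
    rw [← sub_eq_zero.1 h] at hw
    simp at hw
  have him : ∀ w ∈ ball (0 : ℂ) 1, 0 < (Complex.I * ((1 + w) / (1 - w))).im := by
    intro w hw
    have h1 : 0 < Complex.normSq (1 - w) := Complex.normSq_pos.2 (hne1 w hw)
    have h2 : Complex.normSq w < 1 := by
      rw [Complex.normSq_eq_norm_sq]
      have : ‖w‖ < 1 := by simpa using hw
      nlinarith [norm_nonneg w]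
    rw [Complex.I_mul_im, Complex.div_re, ← add_div]
    apply div_pos _ h1
    rw [Complex.normSq_apply] at h2
    simp only [Complex.add_re, Complex.add_im, Complex.sub_re, Complex.sub_im, Complex.one_re,
      Complex.one_im]
    nlinarith
  obtain ⟨ν, hν⟩ := exists_finiteMeasure_sphere_herglotz
    (F := fun w => -Complex.I * V (Complex.I * ((1 + w) / (1 - w))))
    (DifferentiableOn.const_mul (hV.comp (DifferentiableOn.const_mul
      (DifferentiableOn.div (by fun_prop) (by fun_prop) hne1) _) him) _)
    (fun w hw => by simpa using hV0 _ (him w hw))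
  -- The Cayley transform sends `ζ = 1` to infinity, so the mass at this point becomes the linear
  -- coefficient `L`. The rest of the circle is carried to the line by `φ`.
  let one : sphere (0 : ℂ) 1 := ⟨1, by simp⟩
  let φ : sphere (0 : ℂ) 1 → ℝ := fun ζ => (Complex.I * ((1 + (ζ : ℂ)) / (1 - (ζ : ℂ)))).re
  have hφm : Measurable φ := by
    refine Complex.measurable_re.comp (measurable_const.mul ?_)
    exact (measurable_const.add measurable_subtype_coe).div
      (measurable_const.sub measurable_subtype_coe)
  have hφ : ∀ ζ : sphere (0 : ℂ) 1, ζ ≠ one →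
      (φ ζ : ℂ) * (1 - ζ) = Complex.I * (1 + (ζ : ℂ)) ∧ (1 : ℂ) - ζ ≠ 0 := by
    rintro ⟨ζ, hζ⟩ hne
    have h1 : (1 : ℂ) - ζ ≠ 0 := by
      intro h
      exact hne (Subtype.ext (sub_eq_zero.1 h).symm)
    refine ⟨?_, h1⟩
    have hn : ζ.re * ζ.re + ζ.im * ζ.im = 1 := by
      rw [← Complex.normSq_apply, Complex.normSq_eq_norm_sq]
      have : ‖ζ‖ = 1 := by simpa using hζ
      simp [this]
    have hreal : (φ ⟨ζ, hζ⟩ : ℂ) = Complex.I * ((1 + ζ) / (1 - ζ)) := by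
      apply Complex.ext
      · simp [φ]
      · rw [Complex.ofReal_im, Complex.I_mul_im, Complex.div_re, ← add_div]
        symm
        apply div_eq_zero_iff.2
        left
        simp only [Complex.add_re, Complex.add_im, Complex.sub_re, Complex.sub_im, Complex.one_re,
          Complex.one_im]
        linarith
    rw [hreal, mul_assoc, div_mul_cancel₀ _ h1]
  let ν' : Measure ℝ := ((ν : Measure (sphere (0 : ℂ) 1)).restrict {one}ᶜ).map φ
  have hdm : Measurable (fun t : ℝ => (1 + t ^ 2).toNNReal) := by fun_prop
  have hd : ∀ t : ℝ, (((1 + t ^ 2).toNNReal : NNReal) : ℝ) = 1 + t ^ 2 := fun t =>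
    Real.coe_toNNReal _ (by positivity)
  have hνf : IsFiniteMeasure ν' := Measure.isFiniteMeasure_map _ _
  refine ⟨(ν : Measure (sphere (0 : ℂ) 1)).real {one},
    ν'.withDensity (fun t => ((1 + t ^ 2).toNNReal : ENNReal)), measureReal_nonneg, ?_, ?_⟩
  · rw [integrable_withDensity_iff_integrable_smul hdm]
    refine (integrable_const (1 : ℝ)).congr (Filter.Eventually.of_forall fun t => ?_)
    have : (1 + t ^ 2 : ℝ) ≠ 0 := by positivity
    simp only [NNReal.smul_def, hd, smul_eq_mul]
    field_simp
  · intro z hz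
    have hzI : z + Complex.I ≠ 0 := by
      intro h
      have := congrArg Complex.im h
      simp at this
      linarith
    have hw : (z - Complex.I) / (z + Complex.I) ∈ ball (0 : ℂ) 1 := by
      rw [mem_ball_zero_iff, norm_div, div_lt_one (norm_pos_iff.2 hzI)]
      rw [← abs_norm (z - Complex.I), ← abs_norm (z + Complex.I), ← sq_lt_sq,
        ← Complex.normSq_eq_norm_sq, ← Complex.normSq_eq_norm_sq, Complex.normSq_apply,
        Complex.normSq_apply]
      simp
      nlinarith
    have hz' := hν _ hw
    set w := (z - Complex.I) / (z + Complex.I) with hwdef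
    have hw1 := hne1 w hw
    have hzw : Complex.I * ((1 + w) / (1 - w)) = z := by
      have h1 : w * (z + Complex.I) = z - Complex.I := div_mul_cancel₀ _ hzI
      rw [← mul_div_assoc, div_eq_iff hw1]
      linear_combination (1 : ℂ) * h1
    have hcirc : ∀ ζ : sphere (0 : ℂ) 1, (ζ : ℂ) - w ≠ 0 := by
      rintro ⟨ζ, hζ⟩ h
      rw [show ζ = w from sub_eq_zero.1 h] at hζ
      simp at hζ hw
      linarith
    have hcont : Continuous (fun ζ : sphere (0 : ℂ) 1 => ((ζ : ℂ) + w) / ((ζ : ℂ) - w)) :=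
      Continuous.div (by fun_prop) (by fun_prop) hcirc
    have hint : Integrable (fun ζ : sphere (0 : ℂ) 1 => ((ζ : ℂ) + w) / ((ζ : ℂ) - w))
        (ν : Measure (sphere (0 : ℂ) 1)) :=
      BoundedContinuousFunction.integrable _ (BoundedContinuousFunction.mkOfCompact ⟨_, hcont⟩)
    -- With `t = φ ζ` one has `i(ζ + w) / (ζ - w) = (1 + tz) / (t - z)`, which is `1 + t²` times the
    -- Nevanlinna kernel. Hence the density `1 + t²`.
    have hker : ∫ t : ℝ, (1 / ((t : ℂ) - z) - (t : ℂ) / (1 + (t : ℂ) ^ 2))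
        ∂(ν'.withDensity (fun t => ((1 + t ^ 2).toNNReal : ENNReal))) =
        Complex.I * ∫ ζ in {one}ᶜ, ((ζ : ℂ) + w) / ((ζ : ℂ) - w)
          ∂(ν : Measure (sphere (0 : ℂ) 1)) := by
      rw [integral_withDensity_eq_integral_smul hdm, integral_map hφm.aemeasurable,
        ← integral_const_mul]
      · refine setIntegral_congr_fun (measurableSet_singleton one).compl fun ζ hζ => ?_
        obtain ⟨h1, h2⟩ := hφ ζ hζ
        have h3 : (φ ζ : ℂ) - z ≠ 0 := Complex.ofReal_sub_ne_zero_of_im hz.ne' _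
        simp only [NNReal.smul_def, hd, Complex.real_smul]
        push_cast
        rw [Complex.mul_sub_inv_kernel h3 (Complex.one_add_ofReal_sq_ne_zero _), div_eq_iff h3,
          ← mul_div_assoc, div_mul_eq_mul_div, eq_div_iff (hcirc ζ)]
        have h4 : w * (z + Complex.I) = z - Complex.I := div_mul_cancel₀ _ hzI
        have h5 : (φ ζ : ℂ) = Complex.I * (1 + (ζ : ℂ)) / (1 - ζ) := by
          rw [eq_div_iff h2, h1]
        have h6 : w = (z - Complex.I) / (z + Complex.I) := hwdef
        rw [h5, h6]
        field_simp
        linear_combination (2 * ζ * z - ζ ^ 2 * Complex.I - ζ ^ 2 * z + Complex.I - z) * hI2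
      · have : Measurable fun t : ℝ => ((1 + t ^ 2).toNNReal : NNReal) •
            (1 / ((t : ℂ) - z) - (t : ℂ) / (1 + (t : ℂ) ^ 2)) := by
          refine hdm.smul ?_
          fun_prop
        exact this.aestronglyMeasurable
    rw [hker]
    have hsplit := integral_add_compl (measurableSet_singleton one) hint
    rw [integral_singleton] at hsplit
    have hone : (((one : sphere (0 : ℂ) 1) : ℂ) + w) / ((one : ℂ) - w) = (1 + w) / (1 - w) := rfl
    rw [← hsplit, hone, hzw] at hz'
    simp only [add_zero, sub_zero, mul_one, neg_mul, Complex.neg_im, Complex.I_mul_im,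
      Complex.real_smul, ne_eq, one_ne_zero, not_false_eq_true, div_self] at hz'
    have hL : Complex.I * ((1 + w) / (1 - w)) = z := hzw
    push_cast at hz'
    linear_combination Complex.I * hz' + (V z - (V Complex.I).re) * hI2 +
      ((ν : Measure (sphere (0 : ℂ) 1)).real {one} : ℂ) * hL

/-! ### Integrals of the Nevanlinna kernel along the imaginary axis. -/

section NevanlinnaKernel

open Filter Topology

variable {μ : Measure ℝ}

theorem integrable_nevanlinna_kernel (hμ : Integrable (fun t : ℝ => 1 / (1 + t ^ 2)) μ) {z : ℂ}
    (hz : z.im ≠ 0) :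
    Integrable (fun t : ℝ => 1 / ((t : ℂ) - z) - (t : ℂ) / (1 + (t : ℂ) ^ 2)) μ := by
  refine Integrable.mono' (hμ.const_mul (‖z‖ + ‖1 + z ^ 2‖ / |z.im|)) ?_ ?_
  · exact Measurable.aestronglyMeasurable (by fun_prop)
  · refine Eventually.of_forall fun t => ?_
    have h1 := Complex.ofReal_sub_ne_zero_of_im hz t
    have h2 := Complex.one_add_ofReal_sq_ne_zero t
    -- The factor in front of `1 / (1 + t²)` is bounded in `t`, because `|t - z| ≥ |Im z|`.
    have h3 : 1 / ((t : ℂ) - z) - (t : ℂ) / (1 + (t : ℂ) ^ 2) =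
        (z + (1 + z ^ 2) / ((t : ℂ) - z)) * ((1 / (1 + t ^ 2) : ℝ) : ℂ) := by
      push_cast
      field_simp
      ring
    have h4 : |z.im| ≤ ‖(t : ℂ) - z‖ := by
      simpa using Complex.abs_im_le_norm ((t : ℂ) - z)
    have h5 : 0 < |z.im| := abs_pos.2 hz
    rw [h3, norm_mul, Complex.norm_real, Real.norm_of_nonneg (by positivity)]
    refine mul_le_mul_of_nonneg_right ?_ (by positivity)
    refine (norm_add_le _ _).trans ?_
    rw [norm_div]
    gcongr

theorem im_inv_ofReal_sub_mul_I (t y : ℝ) :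
    (1 / ((t : ℂ) - y * Complex.I)).im = y / (t ^ 2 + y ^ 2) := by
  rw [one_div, Complex.inv_im, Complex.normSq_apply]
  simp [pow_two]

theorem im_nevanlinna_kernel (t y : ℝ) :
    (1 / ((t : ℂ) - y * Complex.I) - (t : ℂ) / (1 + (t : ℂ) ^ 2)).im = y / (t ^ 2 + y ^ 2) := by
  rw [Complex.sub_im, im_inv_ofReal_sub_mul_I]
  have : (t : ℂ) / (1 + (t : ℂ) ^ 2) = ((t / (1 + t ^ 2) : ℝ) : ℂ) := by push_cast; rfl
  rw [this, Complex.ofReal_im, sub_zero]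

theorem im_integral_nevanlinna_kernel (hμ : Integrable (fun t : ℝ => 1 / (1 + t ^ 2)) μ) {y : ℝ}
    (hy : y ≠ 0) :
    (∫ t : ℝ, (1 / ((t : ℂ) - y * Complex.I) - (t : ℂ) / (1 + (t : ℂ) ^ 2)) ∂μ).im =
      ∫ t : ℝ, y / (t ^ 2 + y ^ 2) ∂μ := by
  have := integral_im (𝕜 := ℂ)
    (integrable_nevanlinna_kernel hμ (z := y * Complex.I) (by simpa using hy))
  simp only [RCLike.im_eq_complex_im, im_nevanlinna_kernel] at this
  exact this.symm

theorem integral_nevanlinna_kernel_I :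
    ∫ t : ℝ, (1 / ((t : ℂ) - Complex.I) - (t : ℂ) / (1 + (t : ℂ) ^ 2)) ∂μ =
      (∫ t : ℝ, 1 / (1 + t ^ 2) ∂μ : ℝ) * Complex.I := by
  rw [← integral_complex_ofReal, ← integral_mul_const]
  refine integral_congr_ae (Eventually.of_forall fun t => ?_)
  have h1 := Complex.ofReal_sub_ne_zero_of_im (z := Complex.I) (by simp) t
  have h2 := Complex.one_add_ofReal_sq_ne_zero t
  push_cast
  field_simp
  linear_combination (1 : ℂ) * Complex.I_sq

theorem integrable_inv_sq_add_sq (hμ : Integrable (fun t : ℝ => 1 / (1 + t ^ 2)) μ) {y : ℝ}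
    (hy : 1 ≤ y) : Integrable (fun t : ℝ => 1 / (t ^ 2 + y ^ 2)) μ := by
  refine hμ.mono' (Measurable.aestronglyMeasurable (by fun_prop)) (Eventually.of_forall fun t => ?_)
  rw [Real.norm_of_nonneg (by positivity)]
  exact one_div_le_one_div_of_le (by positivity) (by nlinarith)

/-- Even for an infinite measure `n · Im V(in)` grows more slowly than `n²`; this rules out the
degenerate case in `LSys.DonoghueClass.of_moebius`. -/
theorem tendsto_integral_inv_sq_add_sq (hμ : Integrable (fun t : ℝ => 1 / (1 + t ^ 2)) μ) :
    Tendsto (fun n : ℕ => ∫ t : ℝ, 1 / (t ^ 2 + (n : ℝ) ^ 2) ∂μ) atTop (𝓝 0) := by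
  rw [← integral_zero ℝ ℝ (μ := μ)]
  refine tendsto_integral_filter_of_dominated_convergence (fun t => 1 / (1 + t ^ 2)) ?_ ?_ hμ ?_
  · exact Eventually.of_forall fun n => Measurable.aestronglyMeasurable (by fun_prop)
  · filter_upwards [eventually_ge_atTop 1] with n hn
    have hn' : (1 : ℝ) ≤ n := by exact_mod_cast hn
    refine Eventually.of_forall fun t => ?_
    rw [Real.norm_of_nonneg (by positivity)]
    exact one_div_le_one_div_of_le (by positivity) (by nlinarith)
  · refine Eventually.of_forall fun t => ?_
    have h : Tendsto (fun n : ℕ => t ^ 2 + (n : ℝ) ^ 2) atTop atTop :=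
      tendsto_atTop_add_const_left _ _
        ((tendsto_pow_atTop two_ne_zero).comp tendsto_natCast_atTop_atTop)
    exact h.inv_tendsto_atTop.congr fun n => (one_div _).symm

theorem tendsto_sq_div_sq_add_sq (t : ℝ) :
    Tendsto (fun n : ℕ => (n : ℝ) ^ 2 / (t ^ 2 + (n : ℝ) ^ 2)) atTop (𝓝 1) := by
  have h : Tendsto (fun n : ℕ => t ^ 2 + (n : ℝ) ^ 2) atTop atTop :=
    tendsto_atTop_add_const_left _ _
      ((tendsto_pow_atTop two_ne_zero).comp tendsto_natCast_atTop_atTop)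
  have h2 : Tendsto (fun n : ℕ => 1 - t ^ 2 * (t ^ 2 + (n : ℝ) ^ 2)⁻¹) atTop
      (𝓝 (1 - t ^ 2 * 0)) := (h.inv_tendsto_atTop.const_mul _).const_sub _
  rw [mul_zero, sub_zero] at h2
  refine h2.congr' ?_
  filter_upwards [eventually_ge_atTop 1] with n hn
  have hn' : (1 : ℝ) ≤ n := by exact_mod_cast hn
  have : t ^ 2 + (n : ℝ) ^ 2 ≠ 0 := by positivity
  field_simp
  ring

theorem tendsto_integral_sq_div_sq_add_sq [IsFiniteMeasure μ] :
    Tendsto (fun n : ℕ => ∫ t : ℝ, (n : ℝ) ^ 2 / (t ^ 2 + (n : ℝ) ^ 2) ∂μ) atTop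
      (𝓝 (μ.real univ)) := by
  have h : ∫ _ : ℝ, (1 : ℝ) ∂μ = μ.real univ := by simp
  rw [← h]
  refine tendsto_integral_of_dominated_convergence (fun _ => 1)
    (fun n => Measurable.aestronglyMeasurable (by fun_prop)) (integrable_const _) ?_
    (Eventually.of_forall tendsto_sq_div_sq_add_sq)
  refine fun n => Eventually.of_forall fun t => ?_
  rw [Real.norm_of_nonneg (by positivity)]
  exact div_le_one_of_le₀ (by nlinarith [sq_nonneg t]) (by positivity)

/-- The integrands increase to 1, so monotone convergence recovers the total mass. This turns
infinite mass into growth of the imaginary part. -/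
theorem tendsto_integral_sq_div_sq_add_sq_atTop
    (hμ : Integrable (fun t : ℝ => 1 / (1 + t ^ 2)) μ) (hμ' : μ univ = ⊤) :
    Tendsto (fun n : ℕ => ∫ t : ℝ, (n : ℝ) ^ 2 / (t ^ 2 + (n : ℝ) ^ 2) ∂μ) atTop atTop := by
  have h1 : Tendsto (fun n : ℕ => ∫⁻ t : ℝ, ENNReal.ofReal ((n : ℝ) ^ 2 / (t ^ 2 + (n : ℝ) ^ 2)) ∂μ)
      atTop (𝓝 (∫⁻ _ : ℝ, 1 ∂μ)) := by
    refine lintegral_tendsto_of_tendsto_of_monotone ?_ ?_ ?_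
    · exact fun n => Measurable.aemeasurable (by fun_prop)
    · refine Eventually.of_forall fun t n m hnm => ENNReal.ofReal_le_ofReal ?_
      have hnm' : (n : ℝ) ≤ m := by exact_mod_cast hnm
      have hn0 : (0 : ℝ) ≤ n := n.cast_nonneg
      -- At `n = 0` the quotient is 0, including `0 / 0` at `t = 0`, so monotonicity starts there
      -- too.
      rcases hn0.eq_or_lt with h | h
      · rw [← h]
        simp only [ne_eq, OfNat.ofNat_ne_zero, not_false_eq_true, zero_pow, zero_div]
        positivity
      · have hm : (0 : ℝ) < m := h.trans_le hnm'
        rw [div_le_div_iff₀ (by positivity) (by positivity)]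
        have : (n : ℝ) ^ 2 ≤ (m : ℝ) ^ 2 := by gcongr
        nlinarith [mul_nonneg (sq_nonneg t) (sub_nonneg.2 this)]
    · refine Eventually.of_forall fun t => ?_
      have := (ENNReal.continuous_ofReal.tendsto 1).comp (tendsto_sq_div_sq_add_sq t)
      simpa [Function.comp_def] using this
  rw [lintegral_one, hμ'] at h1
  refine tendsto_atTop.2 fun C => ?_
  have h2 := (ENNReal.tendsto_nhds_top_iff_nnreal.1 h1 C.toNNReal)
  filter_upwards [h2, eventually_ge_atTop 1] with n hn hn1
  have hn' : (1 : ℝ) ≤ n := by exact_mod_cast hn1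
  have hint : Integrable (fun t : ℝ => (n : ℝ) ^ 2 / (t ^ 2 + (n : ℝ) ^ 2)) μ := by
    refine ((integrable_inv_sq_add_sq hμ hn').const_mul ((n : ℝ) ^ 2)).congr ?_
    exact Eventually.of_forall fun t => by simp only [mul_one_div]
  rw [← ofReal_integral_eq_lintegral_ofReal hint
    (Eventually.of_forall fun t => by positivity)] at hn
  have : ENNReal.ofReal C < ENNReal.ofReal (∫ t : ℝ, (n : ℝ) ^ 2 / (t ^ 2 + (n : ℝ) ^ 2) ∂μ) := hn
  exact (ENNReal.ofReal_lt_ofReal_iff'.1 this).1.le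

theorem integral_div_sq_add_sq_eq (n : ℕ) (hn : (n : ℝ) ≠ 0) :
    ∫ t : ℝ, (n : ℝ) / (t ^ 2 + (n : ℝ) ^ 2) ∂μ =
      (∫ t : ℝ, (n : ℝ) ^ 2 / (t ^ 2 + (n : ℝ) ^ 2) ∂μ) / n := by
  rw [← integral_div]
  congr 1
  ext t
  field_simp

theorem norm_integral_inv_sub_mul_I_le [IsFiniteMeasure μ] {y : ℝ} (hy : 0 < y) :
    ‖∫ t : ℝ, 1 / ((t : ℂ) - y * Complex.I) ∂μ‖ ≤ μ.real univ / y := by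
  have := norm_integral_le_of_norm_le_const (μ := μ) (C := 1 / y)
    (f := fun t : ℝ => 1 / ((t : ℂ) - y * Complex.I)) (Eventually.of_forall fun t => by
      rw [norm_div, norm_one]
      refine one_div_le_one_div_of_le hy ?_
      have := Complex.abs_im_le_norm ((t : ℂ) - y * Complex.I)
      simpa [abs_of_pos hy] using this)
  rwa [one_div_mul_eq_div] at this

theorem integral_nevanlinna_kernel_of_isFiniteMeasure [IsFiniteMeasure μ] {y : ℝ} (hy : 0 < y) :
    ∫ t : ℝ, (1 / ((t : ℂ) - y * Complex.I) - (t : ℂ) / (1 + (t : ℂ) ^ 2)) ∂μ =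
      ∫ t : ℝ, 1 / ((t : ℂ) - y * Complex.I) ∂μ - (∫ t : ℝ, t / (1 + t ^ 2) ∂μ : ℝ) := by
  have h1 : Integrable (fun t : ℝ => 1 / ((t : ℂ) - y * Complex.I)) μ := by
    refine Integrable.of_bound (Measurable.aestronglyMeasurable (by fun_prop)) (1 / y)
      (Eventually.of_forall fun t => ?_)
    rw [norm_div, norm_one]
    refine one_div_le_one_div_of_le hy ?_
    have := Complex.abs_im_le_norm ((t : ℂ) - y * Complex.I)
    simpa [abs_of_pos hy] using this
  have h2 : Integrable (fun t : ℝ => t / (1 + t ^ 2)) μ := by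
    refine Integrable.of_bound (Measurable.aestronglyMeasurable (by fun_prop)) 1
      (Eventually.of_forall fun t => ?_)
    rw [Real.norm_eq_abs, abs_div, abs_of_pos (by positivity : 0 < 1 + t ^ 2)]
    refine div_le_one_of_le₀ ?_ (by positivity)
    nlinarith [sq_abs t, sq_nonneg (|t| - 1)]
  have h3 : Integrable (fun t : ℝ => ((t / (1 + t ^ 2) : ℝ) : ℂ)) μ := h2.ofReal
  rw [← integral_complex_ofReal, ← integral_sub h1 h3]
  push_cast
  rfl

end NevanlinnaKernel

/-! ### The Donoghue class under rotations. -/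

/-- At `z = i` the kernel reduces to `i / (1 + t²)`, so this single value carries both parameters.
-/
theorem LSys.DonoghueClass.apply_I {κ Q : ℝ} {V : ℂ → ℂ} (h : LSys.DonoghueClass κ Q V) :
    V Complex.I = Q + ((1 - κ) / (1 + κ) : ℝ) * Complex.I := by
  obtain ⟨-, -, μ, -, -, h1, h2⟩ := h
  rw [h2 Complex.I (by simp), integral_nevanlinna_kernel_I, h1]

section Moebius

variable {c s : ℝ} {V W : ℂ}

/-- The coefficient matrix of the rotation has determinant `s² + c² = 1`. -/
theorem im_eq_of_moebius (hcs : s ^ 2 + c ^ 2 = 1) (h : W * (s - c * V) = c + s * V) :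
    V.im = W.im * ‖(s : ℂ) - c * V‖ ^ 2 := by
  have h1 := congrArg Complex.re h
  have h2 := congrArg Complex.im h
  simp only [Complex.mul_re, Complex.mul_im, Complex.sub_re, Complex.sub_im, Complex.add_re,
    Complex.add_im, Complex.ofReal_re, Complex.ofReal_im, zero_mul, sub_zero, add_zero,
    zero_add] at h1 h2
  rw [← Complex.normSq_eq_norm_sq, Complex.normSq_apply]
  simp only [Complex.mul_re, Complex.mul_im, Complex.sub_re, Complex.sub_im,
    Complex.ofReal_re, Complex.ofReal_im, zero_mul, sub_zero, add_zero]
  linear_combination (-V.im) * hcs - (s - c * V.re) * h2 - c * V.im * h1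

/-- The inverse rotation is obtained by `c ↦ -c`, so `im_eq_of_moebius` applies in both directions.
-/
theorem moebius_symm (h : W * (s - c * V) = c + s * V) :
    V * ((s : ℂ) - ((-c : ℝ) : ℂ) * W) = ((-c : ℝ) : ℂ) + s * W := by
  push_cast
  linear_combination -h

theorem moebius_denom_ne_zero (hc : c ≠ 0) (hV : 0 < V.im) : (s : ℂ) - c * V ≠ 0 := by
  intro h
  have := congrArg Complex.im h
  simp [hc, hV.ne'] at this

end Moebius

open Filter Topology in
/-- A rotation `(c + s V) / (s - c V)` with `c ≠ 0` maps a function of the class with parameters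
`κ`, `Q` into the class with parameters `κ`, `Q'` if it has the right value at `i`. -/
theorem LSys.DonoghueClass.of_moebius {κ Q Q' c s : ℝ} {V W : ℂ → ℂ} (hκ₀ : 0 ≤ κ) (hκ₁ : κ < 1)
    (hV : LSys.DonoghueClass κ Q V) (hc : c ≠ 0) (hcs : s ^ 2 + c ^ 2 = 1)
    (hW : ∀ z : ℂ, 0 < z.im → W z * (s - c * V z) = c + s * V z)
    (hWI : W Complex.I = Q' + ((1 - κ) / (1 + κ) : ℝ) * Complex.I) :
    LSys.DonoghueClass κ Q' W := by
  obtain ⟨hVd, hVm, ν, hν, hνi, -, hVr⟩ := hV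
  have ha : 0 < (1 - κ) / (1 + κ) := div_pos (by linarith) (by linarith)
  unfold LSys.DonoghueClass
  generalize (1 - κ) / (1 + κ) = a at ha hWI ⊢
  have hD : ∀ z : ℂ, 0 < z.im → (s : ℂ) - c * V z ≠ 0 := fun z hz =>
    moebius_denom_ne_zero hc (hVm hz)
  have hWd : DifferentiableOn ℂ W {z | 0 < z.im} := by
    have h1 : DifferentiableOn ℂ (fun z => (c + s * V z) / (s - c * V z)) {z | 0 < z.im} :=
      DifferentiableOn.div (by fun_prop) (by fun_prop) hD
    exact h1.congr fun z hz => (eq_div_iff (hD z hz)).2 (hW z hz)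
  have hWim : ∀ z : ℂ, 0 < z.im → (V z).im = (W z).im * ‖(s : ℂ) - c * V z‖ ^ 2 := fun z hz =>
    im_eq_of_moebius hcs (hW z hz)
  have hWm : ∀ z : ℂ, 0 < z.im → 0 < (W z).im := fun z hz => by
    have h1 : 0 < (V z).im := hVm hz
    rw [hWim z hz] at h1
    exact pos_of_mul_pos_left h1 (by positivity)
  obtain ⟨L, μ, hL, hμ, hWr⟩ := exists_measure_nevanlinna hWd fun z hz => (hWm z hz).le
  have hQ' : (W Complex.I).re = Q' := by simp [hWI]
  rw [hQ'] at hWr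
  let P : ℕ → ℝ := fun n => ∫ t : ℝ, (n : ℝ) ^ 2 / (t ^ 2 + (n : ℝ) ^ 2) ∂μ
  let R : ℕ → ℝ := fun n => ∫ t : ℝ, (n : ℝ) ^ 2 / (t ^ 2 + (n : ℝ) ^ 2) ∂ν
  have hR : Tendsto R atTop atTop := tendsto_integral_sq_div_sq_add_sq_atTop hνi hν
  have hP0 : ∀ n, 0 ≤ P n := fun n => integral_nonneg fun t => by positivity
  have hVim : ∀ n : ℕ, 0 < n → (V ((n : ℝ) * Complex.I)).im = R n / n := by
    intro n hn
    have hn' : (n : ℝ) ≠ 0 := by positivity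
    rw [hVr _ (by simpa using hn), Complex.add_im, im_integral_nevanlinna_kernel hνi hn',
      integral_div_sq_add_sq_eq n hn']
    simp [R]
  have hWim' : ∀ n : ℕ, 0 < n → (W ((n : ℝ) * Complex.I)).im = L * n + P n / n := by
    intro n hn
    have hn' : (n : ℝ) ≠ 0 := by positivity
    rw [hWr _ (by simpa using hn), Complex.add_im, im_integral_nevanlinna_kernel hμ hn',
      integral_div_sq_add_sq_eq n hn']
    simp [P]
  -- From `Im W = Im V / |s - cV|² ≤ 1 / (c² Im V)` and `Im V(in) = R n / n` one gets `L ≤ 1 / (c² R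
  -- n)`, which tends to 0.
  have hL0 : L = 0 := by
    refine le_antisymm ?_ hL
    have hlim : Tendsto (fun n => (c ^ 2)⁻¹ * (R n)⁻¹) atTop (𝓝 ((c ^ 2)⁻¹ * 0)) :=
      hR.inv_tendsto_atTop.const_mul _
    rw [mul_zero] at hlim
    refine ge_of_tendsto hlim ?_
    filter_upwards [eventually_gt_atTop 0, hR.eventually_gt_atTop 0] with n hn hRn
    have hn' : (0 : ℝ) < n := by exact_mod_cast hn
    have him : 0 < ((n : ℝ) * Complex.I : ℂ).im := by simpa using hn
    have h1 := hWim _ him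
    have h2 : c ^ 2 * (V ((n : ℝ) * Complex.I)).im ^ 2 ≤
        ‖(s : ℂ) - c * V ((n : ℝ) * Complex.I)‖ ^ 2 := by
      rw [← Complex.normSq_eq_norm_sq, Complex.normSq_apply]
      simp only [Complex.mul_re, Complex.mul_im, Complex.sub_re, Complex.sub_im,
        Complex.ofReal_re, Complex.ofReal_im, zero_mul, sub_zero, add_zero]
      nlinarith [sq_nonneg (s - c * (V ((n : ℝ) * Complex.I)).re)]
    have h3 : L * n ≤ (W ((n : ℝ) * Complex.I)).im := by
      rw [hWim' n hn]
      have := div_nonneg (hP0 n) hn'.le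
      linarith
    rw [hVim n hn] at h1 h2
    have h4 : L * n * (c ^ 2 * (R n / n) ^ 2) ≤ R n / n := by
      rw [h1]
      rw [← h1]
      calc L * n * (c ^ 2 * (R n / n) ^ 2)
          ≤ (W ((n : ℝ) * Complex.I)).im * ‖(s : ℂ) - c * V ((n : ℝ) * Complex.I)‖ ^ 2 := by
            refine mul_le_mul h3 h2 (by positivity) (hWm _ him).le
        _ = R n / n := h1.symm
    have hc2 : 0 < c ^ 2 := by positivity
    rw [← mul_inv, ← one_div, le_div_iff₀ (by positivity)]
    have h5 : L * n * (c ^ 2 * (R n / n) ^ 2) = (L * (c ^ 2 * R n)) * (R n / n) := by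
      field_simp
    rw [h5] at h4
    exact le_of_mul_le_mul_right (by rwa [one_mul]) (div_pos hRn hn')
  subst hL0
  have hμa : ∫ t : ℝ, 1 / (1 + t ^ 2) ∂μ = a := by
    have h1 := hWr Complex.I (by simp)
    rw [integral_nevanlinna_kernel_I, hWI] at h1
    have := congrArg Complex.im h1
    simpa using this.symm
  refine ⟨hWd, hWm, μ, ?_, hμ, hμa, fun z hz => by simpa using hWr z hz⟩
  by_contra hfin
  have : IsFiniteMeasure μ := ⟨lt_top_iff_ne_top.2 hfin⟩
  set m := μ.real univ with hm
  have hm0 : 0 < m := by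
    refine lt_of_le_of_ne measureReal_nonneg fun h => ?_
    have hμ0 : μ = 0 := by
      rw [← Measure.measure_univ_eq_zero]
      exact (measureReal_eq_zero_iff hfin).1 h.symm
    rw [hμ0, integral_zero_measure] at hμa
    linarith
  have hPm : Tendsto P atTop (𝓝 m) := tendsto_integral_sq_div_sq_add_sq
  let G : ℕ → ℂ := fun n => ∫ t : ℝ, 1 / ((t : ℂ) - (n : ℝ) * Complex.I) ∂μ
  -- For a finite `μ`, the denominator `s + cW(in)` of the inverse rotation equals `e + c G n`, and
  -- `e` is its limit.
  let e : ℝ := s + c * (Q' - ∫ t : ℝ, t / (1 + t ^ 2) ∂μ)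
  have hG : ∀ n : ℕ, 0 < n → ‖G n‖ ≤ m / n := fun n hn =>
    norm_integral_inv_sub_mul_I_le (by exact_mod_cast hn)
  have hE : ∀ n : ℕ, 0 < n → P n = R n * ‖(e : ℂ) + c * G n‖ ^ 2 := by
    intro n hn
    have hn' : (0 : ℝ) < n := by exact_mod_cast hn
    have him : 0 < ((n : ℝ) * Complex.I : ℂ).im := by simpa using hn
    have h1 := im_eq_of_moebius (c := -c) (by rw [neg_sq]; exact hcs) (moebius_symm (hW _ him))
    have h2 : (s : ℂ) - ((-c : ℝ) : ℂ) * W ((n : ℝ) * Complex.I) = e + c * G n := by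
      rw [hWr _ him, integral_nevanlinna_kernel_of_isFiniteMeasure hn']
      simp only [e, G]
      push_cast
      ring
    rw [h2, hWim' n hn, hVim n hn, zero_mul, zero_add, div_mul_eq_mul_div,
      div_left_inj' hn'.ne'] at h1
    exact h1
  have hG0 : Tendsto G atTop (𝓝 0) := by
    have h1 : Tendsto (fun n : ℕ => m / (n : ℝ)) atTop (𝓝 0) :=
      tendsto_const_nhds.div_atTop tendsto_natCast_atTop_atTop
    exact squeeze_zero_norm' (by filter_upwards [eventually_gt_atTop 0] with n hn using hG n hn) h1
  -- Finite mass `m > 0` would give `P n → m`. But `P n = R n · |e + c G n|²` tends to 0 if `e = 0`,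
  -- since `|G n| ≤ m / n` and `R n / n² → 0`, and to infinity otherwise.
  by_cases he : e = 0
  · have h1 : Tendsto (fun n : ℕ => (c ^ 2 * m ^ 2) * ∫ t : ℝ, 1 / (t ^ 2 + (n : ℝ) ^ 2) ∂ν) atTop
        (𝓝 ((c ^ 2 * m ^ 2) * 0)) := (tendsto_integral_inv_sq_add_sq hνi).const_mul _
    rw [mul_zero] at h1
    refine absurd (le_of_tendsto_of_tendsto hPm h1 ?_) (not_le.2 hm0)
    filter_upwards [eventually_gt_atTop 0] with n hn
    have hn' : (0 : ℝ) < n := by exact_mod_cast hn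
    have hRn : R n = (n : ℝ) ^ 2 * ∫ t : ℝ, 1 / (t ^ 2 + (n : ℝ) ^ 2) ∂ν := by
      rw [← integral_const_mul]
      simp only [R, mul_one_div]
    have hI0 : 0 ≤ ∫ t : ℝ, 1 / (t ^ 2 + (n : ℝ) ^ 2) ∂ν := integral_nonneg fun t => by positivity
    rw [hE n hn, he, Complex.ofReal_zero, zero_add, norm_mul, Complex.norm_real, mul_pow,
      Real.norm_eq_abs, sq_abs, hRn]
    have h2 : ‖G n‖ ^ 2 ≤ (m / n) ^ 2 := by gcongr; exact hG n hn
    calc (n : ℝ) ^ 2 * (∫ t : ℝ, 1 / (t ^ 2 + (n : ℝ) ^ 2) ∂ν) * (c ^ 2 * ‖G n‖ ^ 2)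
        ≤ (n : ℝ) ^ 2 * (∫ t : ℝ, 1 / (t ^ 2 + (n : ℝ) ^ 2) ∂ν) * (c ^ 2 * (m / n) ^ 2) := by
          gcongr
      _ = _ := by field_simp
  · have h1 : Tendsto (fun n => ‖(e : ℂ) + c * G n‖ ^ 2) atTop (𝓝 (‖(e : ℂ) + c * 0‖ ^ 2)) :=
      ((hG0.const_mul _).const_add _).norm.pow 2
    have h2 : 0 < ‖(e : ℂ) + c * 0‖ ^ 2 := by
      rw [mul_zero, add_zero, Complex.norm_real]
      positivity
    have h3 : Tendsto P atTop atTop := (hR.atTop_mul_pos h2 h1).congr' (by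
      filter_upwards [eventually_gt_atTop 0] with n hn using (hE n hn).symm)
    exact not_tendsto_nhds_of_tendsto_atTop h3 _ hPm

/-- The rotation `(c + s V) / (s - c V)` changes the sign of the parameter `Q` exactly for one
value of `s / c`. -/
theorem LSys.DonoghueClass.neg_iff_of_moebius {κ Q c s : ℝ} {V W : ℂ → ℂ} (hκ₀ : 0 ≤ κ)
    (hκ₁ : κ < 1) (hV : LSys.DonoghueClass κ Q V) (hc : c ≠ 0) (hcs : s ^ 2 + c ^ 2 = 1)
    (hW : ∀ z : ℂ, 0 < z.im → W z * (s - c * V z) = c + s * V z) :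
    LSys.DonoghueClass κ (-Q) W ↔
      2 * s * Q = c * (Q ^ 2 + ((1 - κ) / (1 + κ)) ^ 2 - 1) := by
  have hI := hW Complex.I (by simp)
  have hVI := hV.apply_I
  constructor
  · intro h
    rw [h.apply_I, hVI] at hI
    -- The imaginary part of the equation at `i` is an identity, so only the real part carries
    -- information.
    have := congrArg Complex.re hI
    simp only [Complex.mul_re, Complex.mul_im, Complex.sub_re, Complex.sub_im, Complex.add_re,
      Complex.add_im, Complex.ofReal_re, Complex.ofReal_im, Complex.I_re, Complex.I_im, zero_mul,
      mul_zero, mul_one, sub_zero, add_zero, zero_add, zero_sub] at this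
    linear_combination -this
  · intro h
    refine hV.of_moebius hκ₀ hκ₁ hc hcs hW ?_
    have hD : (s : ℂ) - c * V Complex.I ≠ 0 :=
      moebius_denom_ne_zero hc (hV.2.1 (by simp : 0 < Complex.I.im))
    apply mul_right_cancel₀ hD
    rw [hI, hVI]
    set a := (1 - κ) / (1 + κ)
    have h' : 2 * (s : ℂ) * Q = c * (Q ^ 2 + a ^ 2 - 1) := by exact_mod_cast h
    push_cast
    linear_combination h' + (c : ℂ) * a ^ 2 * Complex.I_sq

/-! ### Ranges of self-adjoint operators and of one-dimensional extensions. -/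

section Range

variable {H : Type*} [NormedAddCommGroup H] [InnerProductSpace ℂ H]

/-- In `Im ⟪x, y - zx⟫ = Im ⟪x, y⟫ - Im z ‖x‖²` the sign hypothesis excludes cancellation;
Cauchy–Schwarz does the rest. -/
theorem abs_im_mul_norm_le_norm_sub_smul {x y : H} {z : ℂ} (h : (⟪x, y⟫_ℂ).im * z.im ≤ 0) :
    |z.im| * ‖x‖ ≤ ‖y - z • x‖ := by
  rcases eq_or_ne x 0 with rfl | hx
  · simp
  have h1 : (⟪x, y - z • x⟫_ℂ).im = (⟪x, y⟫_ℂ).im - z.im * ‖x‖ ^ 2 := by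
    rw [inner_sub_right, inner_smul_right, inner_self_eq_norm_sq_to_K]
    simp [← Complex.ofReal_pow]
  have h2 : |(⟪x, y - z • x⟫_ℂ).im| ≤ ‖x‖ * ‖y - z • x‖ :=
    (Complex.abs_im_le_norm _).trans (norm_inner_le_norm _ _)
  have h3 : |z.im| * ‖x‖ ^ 2 ≤ |(⟪x, y - z • x⟫_ℂ).im| := by
    rw [h1]
    have hn : 0 ≤ ‖x‖ ^ 2 := by positivity
    rcases lt_trichotomy z.im 0 with hz | hz | hz
    · have : 0 ≤ (⟪x, y⟫_ℂ).im := nonneg_of_mul_nonpos_left h hz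
      rw [abs_of_neg hz]
      refine le_trans ?_ (le_abs_self _)
      linarith
    · rw [hz]
      simp
    · have : (⟪x, y⟫_ℂ).im ≤ 0 := nonpos_of_mul_nonpos_left h hz
      rw [abs_of_pos hz]
      refine le_trans ?_ (neg_le_abs _)
      linarith
  have h4 : ‖x‖ * (|z.im| * ‖x‖) ≤ ‖x‖ * ‖y - z • x‖ := by
    calc ‖x‖ * (|z.im| * ‖x‖) = |z.im| * ‖x‖ ^ 2 := by ring
      _ ≤ _ := h3.trans h2
  exact le_of_mul_le_mul_left h4 (norm_pos_iff.2 hx)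

/-- The map `(x, y) ↦ y - z x` on the graph of an operator. -/
def subSmul (H : Type*) [NormedAddCommGroup H] [InnerProductSpace ℂ H] (z : ℂ) : H × H →L[ℂ] H :=
  ContinuousLinearMap.snd ℂ H H - z • ContinuousLinearMap.fst ℂ H H

theorem subSmul_apply (z : ℂ) (p : H × H) : subSmul H z p = p.2 - z • p.1 := rfl

/-- Let `GT` and `GB` be relations extending `GA`, the former by one dimension. If `GT - w` is
surjective at a point `w` where `GB - w` is bijective, then `GT - z` is surjective at every `z` at
which it is injective and `GB - z` is surjective. -/
theorem exists_subSmul_eq_of_one_dim_extension {GA GT GB : Submodule ℂ (H × H)} (hAT : GA ≤ GT)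
    (hAB : GA ≤ GB) {p₀ : H × H} (hp₀ : p₀ ∈ GT) (hp₀A : p₀ ∉ GA)
    (hspan : ∀ p ∈ GT, ∃ c : ℂ, p - c • p₀ ∈ GA) {w z : ℂ}
    (hTw : ∀ h, ∃ p ∈ GT, subSmul H w p = h) (hBw : ∀ h, ∃ p ∈ GB, subSmul H w p = h)
    (hBw' : ∀ p ∈ GB, subSmul H w p = 0 → p = 0)
    (hBz : ∀ h, ∃ p ∈ GB, subSmul H z p = h) (hTz : ∀ p ∈ GT, subSmul H z p = 0 → p = 0) (h : H) :
    ∃ p ∈ GT, subSmul H z p = h := by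
  obtain ⟨e, he, hew⟩ := hBw (subSmul H w p₀)
  -- Comparison at `w` shows that `GB` is `GA` plus the span of `e`, so it too is an extension by at
  -- most one dimension.
  have hdec : ∀ q ∈ GB, ∃ c : ℂ, q - c • e ∈ GA := by
    intro q hq
    obtain ⟨p, hp, hpq⟩ := hTw (subSmul H w q)
    obtain ⟨c, hc⟩ := hspan p hp
    refine ⟨c, ?_⟩
    have h0 : q - c • e - (p - c • p₀) = 0 := by
      refine hBw' _ (GB.sub_mem (GB.sub_mem hq (GB.smul_mem c he)) (hAB hc)) ?_
      simp only [map_sub, map_smul, hpq, hew, sub_self]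
    rwa [sub_eq_zero.1 h0]
  obtain ⟨e', he', hez⟩ := hBz (subSmul H z p₀)
  obtain ⟨c, hc⟩ := hdec e' he'
  -- Otherwise `e'` would lie in `GA ≤ GT` with the same image as `p₀`, and injectivity of `GT - z`
  -- would put `p₀` in `GA`.
  have hc0 : c ≠ 0 := by
    rintro rfl
    rw [zero_smul, sub_zero] at hc
    have h0 : p₀ - e' = 0 := hTz _ (GT.sub_mem hp₀ (hAT hc)) (by rw [map_sub, hez, sub_self])
    rw [← sub_eq_zero.1 h0] at hc
    exact hp₀A hc
  obtain ⟨q, hq, hqh⟩ := hBz h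
  obtain ⟨d, hd⟩ := hdec q hq
  -- Modulo `GA`, `q` is a multiple of `e'`. Replacing `e'` by `p₀`, which has the same image at
  -- `z`, moves the preimage from `GB` to `GT`.
  have ha : q - (d / c) • e' ∈ GA := by
    have : q - (d / c) • e' = (q - d • e) - (d / c) • (e' - c • e) := by
      rw [smul_sub, smul_smul, div_mul_cancel₀ _ hc0]
      abel
    rw [this]
    exact GA.sub_mem hd (GA.smul_mem _ hc)
  refine ⟨q - (d / c) • e' + (d / c) • p₀, GT.add_mem (hAT ha) (GT.smul_mem _ hp₀), ?_⟩
  simp only [map_add, map_sub, map_smul, hez, hqh]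
  abel

theorem LSys.mem_resolventSet_of_bound {T : H →ₗ.[ℂ] H} {z : ℂ} {C : ℝ} (hC : 0 < C)
    (hbound : ∀ p ∈ T.graph, C * ‖p.1‖ ≤ ‖subSmul H z p‖)
    (hsurj : ∀ h, ∃ p ∈ T.graph, subSmul H z p = h) : z ∈ LSys.resolventSet T := by
  let g : T.domain →ₗ[ℂ] H := T.toFun - z • T.domain.subtype
  have hg : ∀ x : T.domain, g x = T x - z • (x : H) := fun x => rfl
  have hgb : ∀ x : T.domain, C * ‖(x : H)‖ ≤ ‖g x‖ := fun x => hbound _ (T.mem_graph x)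
  have hinj : Function.Injective g := by
    rw [injective_iff_map_eq_zero]
    intro x hx
    have h1 := hgb x
    rw [hx, norm_zero] at h1
    exact Subtype.ext (norm_le_zero_iff.1 (nonpos_of_mul_nonpos_right h1 hC))
  have hsur : Function.Surjective g := by
    intro h
    obtain ⟨p, hp, hph⟩ := hsurj h
    obtain ⟨x, hx1, hx2⟩ := LinearPMap.mem_graph_iff _ |>.1 hp
    refine ⟨x, ?_⟩
    rw [hg, hx1, hx2]
    exact hph
  let E := LinearEquiv.ofBijective g ⟨hinj, hsur⟩
  have hE : ∀ h, g (E.symm h) = h := fun h => E.apply_symm_apply h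
  refine ⟨(T.domain.subtype.comp (E.symm : H →ₗ[ℂ] T.domain)).mkContinuous C⁻¹ fun h => ?_,
    fun h => ⟨E.symm h, rfl, hE h⟩, fun x => ?_⟩
  · have h1 := hgb (E.symm h)
    rw [hE] at h1
    rw [inv_mul_eq_div, le_div_iff₀ hC, mul_comm]
    exact h1
  · exact congrArg Subtype.val (E.symm_apply_apply x)

variable [CompleteSpace H]

theorem im_inner_eq_zero_of_isSelfAdjoint {B : H →ₗ.[ℂ] H} (hB : IsSelfAdjoint B) {p : H × H}
    (hp : p ∈ B.graph) : (⟪p.1, p.2⟫_ℂ).im = 0 := by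
  obtain ⟨x, hx1, hx2⟩ := LinearPMap.mem_graph_iff _ |>.1 hp
  have h := LinearPMap.adjoint_isFormalAdjoint hB.dense_domain
  rw [LinearPMap.isSelfAdjoint_def.1 hB] at h
  have h1 := h x x
  rw [hx1, hx2] at h1
  have h2 := congrArg Complex.im (inner_conj_symm (𝕜 := ℂ) p.1 p.2)
  rw [h1, Complex.conj_im] at h2
  linarith

theorem norm_le_of_isSelfAdjoint {B : H →ₗ.[ℂ] H} (hB : IsSelfAdjoint B) (z : ℂ) {p : H × H}
    (hp : p ∈ B.graph) : |z.im| * ‖p.1‖ ≤ ‖subSmul H z p‖ :=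
  abs_im_mul_norm_le_norm_sub_smul (y := p.2)
    (by rw [im_inner_eq_zero_of_isSelfAdjoint hB hp, zero_mul])

/-- A self-adjoint operator minus a nonreal number is injective. -/
theorem eq_zero_of_subSmul_eq_zero_of_isSelfAdjoint {B : H →ₗ.[ℂ] H} (hB : IsSelfAdjoint B) {z : ℂ}
    (hz : z.im ≠ 0) {p : H × H} (hp : p ∈ B.graph) (h : subSmul H z p = 0) : p = 0 := by
  have h1 := norm_le_of_isSelfAdjoint hB z hp
  rw [h, norm_zero] at h1
  have h2 : p.1 = 0 := norm_le_zero_iff.1 (nonpos_of_mul_nonpos_right h1 (abs_pos.2 hz))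
  rw [subSmul_apply, h2, smul_zero, sub_zero] at h
  exact Prod.ext h2 h

/-- A self-adjoint operator minus a nonreal number is surjective. -/
theorem exists_subSmul_eq_of_isSelfAdjoint {B : H →ₗ.[ℂ] H} (hB : IsSelfAdjoint B) {z : ℂ}
    (hz : z.im ≠ 0) (h : H) : ∃ p ∈ B.graph, subSmul H z p = h := by
  let f : B.graph →L[ℂ] H := (subSmul H z).comp B.graph.subtypeL
  have hz' : 0 < |z.im| := abs_pos.2 hz
  have hclosed : IsClosed (LinearMap.range (f : B.graph →ₗ[ℂ] H) : Set H) := by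
    have hcomplete : CompleteSpace B.graph := IsClosed.completeSpace_coe (hs := hB.isClosed)
    have hbound : ∀ p : B.graph,
        ‖p‖ ≤ ((1 + ‖z‖) / |z.im| + 1 : ℝ).toNNReal * ‖f p‖ := by
      rintro ⟨p, hp⟩
      have h1 : |z.im| * ‖p.1‖ ≤ ‖p.2 - z • p.1‖ := norm_le_of_isSelfAdjoint hB z hp
      rw [Real.coe_toNNReal _ (by positivity)]
      change ‖p‖ ≤ _ * ‖p.2 - z • p.1‖
      set r := ‖p.2 - z • p.1‖ with hr
      have hr0 : 0 ≤ r := norm_nonneg _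
      have h2 : ‖p.1‖ ≤ r / |z.im| := by
        rw [le_div_iff₀ hz']
        linarith
      have h3 : ‖p.2‖ ≤ r + ‖z‖ * ‖p.1‖ := by
        have : p.2 = (p.2 - z • p.1) + z • p.1 := by abel
        calc ‖p.2‖ = ‖(p.2 - z • p.1) + z • p.1‖ := by rw [← this]
          _ ≤ r + ‖z • p.1‖ := norm_add_le _ _
          _ = _ := by rw [norm_smul]
      have h4 : ‖z‖ * ‖p.1‖ ≤ ‖z‖ * (r / |z.im|) := by gcongr
      have h5 : ((1 + ‖z‖) / |z.im| + 1) * r = r / |z.im| + ‖z‖ * (r / |z.im|) + r := by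
        field_simp
      have h6 : 0 ≤ r / |z.im| := by positivity
      have h7 : 0 ≤ ‖z‖ * (r / |z.im|) := by positivity
      rw [h5, Prod.norm_def]
      exact max_le (by linarith) (by linarith)
    exact (AddMonoidHomClass.antilipschitz_of_bound f hbound).isClosed_range f.uniformContinuous
  -- A vector orthogonal to the range lies in the kernel of `B* - conj z = B - conj z`, which is
  -- trivial.
  have hdense : (LinearMap.range (f : B.graph →ₗ[ℂ] H))ᗮ = ⊥ := by
    rw [eq_bot_iff]
    intro y hy
    have h1 : ∀ x : B.domain, ⟪conj z • y, (x : H)⟫_ℂ = ⟪y, B x⟫_ℂ := by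
      intro x
      have h2 : ⟪f ⟨_, B.mem_graph x⟩, y⟫_ℂ = 0 := hy _ ⟨⟨_, B.mem_graph x⟩, rfl⟩
      have h3 : ⟪y, B x - z • (x : H)⟫_ℂ = 0 := inner_eq_zero_symm.1 h2
      rw [inner_sub_right, inner_smul_right, sub_eq_zero] at h3
      rw [inner_smul_left, Complex.conj_conj, h3]
    have h2 : y ∈ B.adjoint.domain := LinearPMap.mem_adjoint_domain_of_exists y ⟨_, h1⟩
    have h3 : B.adjoint ⟨y, h2⟩ = conj z • y :=
      LinearPMap.adjoint_apply_eq hB.dense_domain ⟨y, h2⟩ h1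
    have h4 : (y, conj z • y) ∈ B.graph := by
      rw [← LinearPMap.isSelfAdjoint_def.1 hB, ← h3]
      exact B.adjoint.mem_graph ⟨y, h2⟩
    have h5 := eq_zero_of_subSmul_eq_zero_of_isSelfAdjoint hB (z := conj z) (by simpa using hz) h4
      (by rw [subSmul_apply, sub_self])
    exact congrArg Prod.fst h5
  have htop : LinearMap.range (f : B.graph →ₗ[ℂ] H) = ⊤ := by
    have := hclosed.completeSpace_coe
    exact Submodule.orthogonal_eq_bot_iff.1 hdense
  obtain ⟨p, hp⟩ := LinearMap.range_eq_top.1 htop h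
  exact ⟨p, p.2, hp⟩

/-- If `T - w` is boundedly invertible, then `T - w'` is surjective for some nonreal `w'`. -/
theorem LSys.exists_nonreal_surjective {T : H →ₗ.[ℂ] H} (hT : (LSys.resolventSet T).Nonempty) :
    ∃ w : ℂ, w.im ≠ 0 ∧ ∀ h, ∃ p ∈ T.graph, subSmul H w p = h := by
  obtain ⟨w, R, hR, -⟩ := hT
  by_cases hw : w.im = 0
  · set δ : ℝ := 1 / (2 * (‖R‖ + 1)) with hδ
    have hn := norm_nonneg R
    have hδ0 : 0 < δ := by positivity
    have hlt : ‖((δ : ℂ) * Complex.I) • R‖ < 1 := by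
      rw [norm_smul, norm_mul, Complex.norm_I, mul_one, Complex.norm_real,
        Real.norm_of_nonneg hδ0.le, hδ, one_div_mul_eq_div, div_lt_one (by positivity)]
      linarith
    have hunit := isUnit_one_sub_of_norm_lt_one hlt
    obtain ⟨U, hU⟩ := hunit
    refine ⟨w + δ * Complex.I, by simp [hw, hδ0.ne'], fun h => ?_⟩
    set k := (↑U⁻¹ : H →L[ℂ] H) h with hk
    have hk' : k - ((δ : ℂ) * Complex.I) • R k = h := by
      have h1 : (U : H →L[ℂ] H) ((↑U⁻¹ : H →L[ℂ] H) h) = h := by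
        rw [← mul_apply_eq_comp, Units.mul_inv]
        rfl
      rw [hU] at h1
      exact h1
    obtain ⟨x, hx, hx'⟩ := hR k
    refine ⟨_, T.mem_graph x, ?_⟩
    change T x - (w + δ * Complex.I) • (x : H) = h
    rw [add_smul, ← sub_sub, hx', hx, hk']
  · refine ⟨w, hw, fun h => ?_⟩
    obtain ⟨x, -, hx⟩ := hR h
    exact ⟨_, T.mem_graph x, hx⟩

end Range

/-! ### The rigged triple and bi-extensions. -/

namespace LSys

section Rigging

variable {H : Type*} [NormedAddCommGroup H] [InnerProductSpace ℂ H] [CompleteSpace H]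
  {A : H →ₗ.[ℂ] H}

theorem incl_injective : Function.Injective (incl A) := by
  rw [injective_iff_map_eq_zero]
  rintro ⟨p, hp⟩ h
  have h1 : p.fst = 0 := h
  have h2 : (p.fst, p.snd) ∈ A.adjoint.graph := hp
  obtain ⟨x, hx1, hx2⟩ := LinearPMap.mem_graph_iff _ |>.1 h2
  have hx : x = 0 := Subtype.ext (hx1.trans h1)
  have h3 : p.snd = 0 := by
    change A.adjoint x = p.snd at hx2
    rw [← hx2, hx, LinearPMap.map_zero]
  refine Subtype.ext ?_
  exact (WithLp.linearEquiv 2 ℂ (H × H)).injective (Prod.ext h1 h3)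

theorem toMinus_sub (h k : H) : toMinus A (h - k) = toMinus A h - toMinus A k := by
  ext u
  simp [toMinus_apply]

theorem toMinus_smul (c : ℂ) (h : H) : toMinus A (c • h) = c • toMinus A h := by
  ext u
  simp [toMinus_apply]

theorem toMinus_injective (hd : Dense (Set.range (incl A))) : Function.Injective (toMinus A) := by
  intro h k hk
  have h1 : ∀ u ∈ Set.range (incl A), ⟪u, h⟫_ℂ = ⟪u, k⟫_ℂ := by
    rintro _ ⟨f, rfl⟩
    exact DFunLike.congr_fun hk f
  have h2 : (fun u : H => ⟪u, h⟫_ℂ) = fun u => ⟪u, k⟫_ℂ :=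
    Continuous.ext_on hd (by fun_prop) (by fun_prop) h1
  exact ext_inner_left ℂ fun u => congrFun h2 u

/-- `Submodule.toLinearPMap` has the given relation as its graph only when that relation is
single-valued. Density makes `H → H₋` injective, which ensures this. -/
theorem mem_graph_quasiKernel (hd : Dense (Set.range (incl A))) {S : HPlus A →L[ℂ] HMinus A}
    {p : H × H} :
    p ∈ (quasiKernel S).graph ↔ ∃ f : HPlus A, incl A f = p.1 ∧ S f = toMinus A p.2 := by
  rw [quasiKernel, Submodule.toLinearPMap_graph_eq]
  · rfl
  · rintro q ⟨f, hf1, hf2⟩ hq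
    rw [hq] at hf1
    have hf : f = 0 := incl_injective (by rw [hf1, map_zero])
    rw [hf, map_zero] at hf2
    apply toMinus_injective hd
    rw [← hf2]
    ext u
    simp [toMinus_apply]

theorem biRe_apply (S : HPlus A →L[ℂ] HMinus A) (f g : HPlus A) :
    biRe S f g = (1 / 2 : ℂ) * (S f g + conj (S g f)) := rfl

theorem biIm_apply (S : HPlus A →L[ℂ] HMinus A) (f g : HPlus A) :
    biIm S f g = (1 / (2 * Complex.I) : ℂ) * (S f g - conj (S g f)) := rfl

theorem biRe_symm (S : HPlus A →L[ℂ] HMinus A) (f g : HPlus A) :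
    conj (biRe S g f) = biRe S f g := by
  simp only [biRe_apply, map_mul, map_add, Complex.conj_conj, map_div₀, map_one, map_ofNat]
  ring

theorem eq_biRe_add_biIm (S : HPlus A →L[ℂ] HMinus A) (f : HPlus A) :
    S f = biRe S f + Complex.I • biIm S f := by
  ext g
  change S f g = biRe S f g + Complex.I * biIm S f g
  rw [biRe_apply, biIm_apply]
  have := Complex.I_ne_zero
  field_simp
  ring

theorem biAdjoint_eq_biRe_sub_biIm (S : HPlus A →L[ℂ] HMinus A) (f : HPlus A) :
    biAdjoint S f = biRe S f - Complex.I • biIm S f := by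
  ext g
  change conj (S g f) = biRe S f g - Complex.I * biIm S f g
  rw [biRe_apply, biIm_apply]
  have := Complex.I_ne_zero
  field_simp
  ring

theorem channel_eq_smul (K : ℂ →L[ℂ] HMinus A) (c : ℂ) : K c = c • K 1 := by
  rw [← map_smul, smul_eq_mul, mul_one]

theorem channelAdjoint_smul (K : ℂ →L[ℂ] HMinus A) (c : ℂ) (f : HPlus A) :
    channelAdjoint K (c • f) = c * channelAdjoint K f := by
  simp [channelAdjoint]

theorem channelAdjoint_sub (K : ℂ →L[ℂ] HMinus A) (f g : HPlus A) :
    channelAdjoint K (f - g) = channelAdjoint K f - channelAdjoint K g := by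
  simp [channelAdjoint]

theorem conj_channelAdjoint (K : ℂ →L[ℂ] HMinus A) (f : HPlus A) :
    conj (channelAdjoint K f) = K 1 f := by
  simp [channelAdjoint]

theorem biResolvent_spec {S : HPlus A →L[ℂ] HMinus A} {z : ℂ} {y : HMinus A}
    (h : ∃ x : HPlus A, S x - z • toMinus A (incl A x) = y) :
    S (biResolvent S z y) - z • toMinus A (incl A (biResolvent S z y)) = y :=
  Function.invFun_eq (f := fun x : HPlus A => S x - z • toMinus A (incl A x)) h

end Rigging

/-! ### Regular points, impedance and transfer function of an L-system. -/

namespace LSystem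

variable {H : Type*} [NormedAddCommGroup H] [InnerProductSpace ℂ H] [CompleteSpace H]
  (Θ : LSystem H)

theorem S_apply (f : HPlus Θ.A) :
    Θ.S f = biRe Θ.S f + (Complex.I * channelAdjoint Θ.K f) • Θ.K 1 := by
  rw [eq_biRe_add_biIm Θ.S f, Θ.im_eq, channel_eq_smul, smul_smul]

theorem biAdjoint_S_apply (f : HPlus Θ.A) :
    biAdjoint Θ.S f = biRe Θ.S f - (Complex.I * channelAdjoint Θ.K f) • Θ.K 1 := by
  rw [biAdjoint_eq_biRe_sub_biIm Θ.S f, Θ.im_eq, channel_eq_smul, smul_smul]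

theorem dense_T : Dense (Θ.T.domain : Set H) :=
  Θ.admissible.dense.mono fun _ hx => Θ.lambda.le.1 hx

theorem dense_range_incl : Dense (Set.range (incl Θ.A)) := by
  refine Θ.dense_T.mono fun x hx => ?_
  obtain ⟨f, hf, -⟩ := Θ.starExtension.ext ⟨x, hx⟩
  exact ⟨f, hf⟩

/-- The graph of the main operator lifts to `H₊`. -/
theorem exists_lift {p : H × H} (hp : p ∈ Θ.T.graph) :
    ∃ f : HPlus Θ.A, incl Θ.A f = p.1 ∧ Θ.S f = toMinus Θ.A p.2 := by
  obtain ⟨x, hx1, hx2⟩ := LinearPMap.mem_graph_iff _ |>.1 hp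
  obtain ⟨f, hf1, hf2⟩ := Θ.starExtension.ext x
  exact ⟨f, by rw [hf1, hx1], by rw [hf2, hx2]⟩

theorem graph_A_le_graph_T : Θ.A.graph ≤ Θ.T.graph := LinearPMap.le_graph_of_le Θ.lambda.le

theorem mem_graph_A {p : H × H} (hp : p ∈ Θ.T.graph) (h : p.1 ∈ Θ.A.domain) :
    p ∈ Θ.A.graph := by
  obtain ⟨x, hx1, hx2⟩ := LinearPMap.mem_graph_iff _ |>.1 hp
  refine LinearPMap.mem_graph_iff _ |>.2 ⟨⟨p.1, h⟩, rfl, ?_⟩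
  rw [← hx2]
  exact Θ.lambda.le.2 hx1.symm

theorem im_S_apply_self (f : HPlus Θ.A) : (Θ.S f f).im = ‖channelAdjoint Θ.K f‖ ^ 2 := by
  have h1 : biIm Θ.S f f = Θ.K (channelAdjoint Θ.K f) f := by rw [Θ.im_eq]
  rw [channelAdjoint_spec, Complex.mul_conj, Complex.normSq_eq_norm_sq, biIm_apply,
    Complex.sub_conj] at h1
  have h2 : ((Θ.S f f).im : ℂ) = ((‖channelAdjoint Θ.K f‖ ^ 2 : ℝ) : ℂ) := by
    rw [← h1]
    have := Complex.I_ne_zero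
    field_simp
    push_cast
    ring
  exact_mod_cast h2

/-- The main operator has a lifted vector on which the channel does not vanish. -/
theorem exists_channelAdjoint_eq_I : ∃ p ∈ Θ.T.graph, ∃ f : HPlus Θ.A,
    incl Θ.A f = p.1 ∧ Θ.S f = toMinus Θ.A p.2 ∧ channelAdjoint Θ.K f = Complex.I := by
  have h : ∃ p ∈ Θ.T.graph, ∃ f : HPlus Θ.A,
      incl Θ.A f = p.1 ∧ Θ.S f = toMinus Θ.A p.2 ∧ channelAdjoint Θ.K f ≠ 0 := by
    -- If the channel vanished on `dom T`, then `𝔸` would agree with `Re 𝔸` there and `T` would be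
    -- symmetric.
    by_contra! hcon
    refine Θ.lambda.not_symmetric fun x y => ?_
    obtain ⟨f, hf1, hf2⟩ := Θ.exists_lift (Θ.T.mem_graph x)
    obtain ⟨g, hg1, hg2⟩ := Θ.exists_lift (Θ.T.mem_graph y)
    have hf3 := Θ.S_apply f
    rw [hcon _ (Θ.T.mem_graph x) f hf1 hf2, mul_zero, zero_smul ℂ (Θ.K 1), add_zero, hf2] at hf3
    have hg3 := Θ.S_apply g
    rw [hcon _ (Θ.T.mem_graph y) g hg1 hg2, mul_zero, zero_smul ℂ (Θ.K 1), add_zero, hg2] at hg3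
    have h1 := biRe_symm Θ.S g f
    rw [← hf3, ← hg3, toMinus_apply, toMinus_apply, hf1, hg1, inner_conj_symm] at h1
    exact h1
  obtain ⟨p, hp, f, hf1, hf2, hf3⟩ := h
  set k := channelAdjoint Θ.K f with hk
  refine ⟨(Complex.I / k) • p, Θ.T.graph.smul_mem _ hp, (Complex.I / k) • f, ?_, ?_, ?_⟩
  · rw [map_smul, hf1, Prod.smul_fst]
  · rw [map_smul, hf2, Prod.smul_snd, toMinus_smul]
  · rw [channelAdjoint_smul, ← hk, div_mul_cancel₀ _ hf3]

/-- When `K* f = 0`, `f` pairs symmetrically with all of `dom T`, hence lies in `dom T ∩ dom T* =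
dom A`. So `A` has codimension at most one in `T`. -/
theorem mem_graph_A_of_channelAdjoint_eq_zero {p : H × H} (hp : p ∈ Θ.T.graph) {f : HPlus Θ.A}
    (hf1 : incl Θ.A f = p.1) (hf2 : Θ.S f = toMinus Θ.A p.2) (hf : channelAdjoint Θ.K f = 0) :
    p ∈ Θ.A.graph := by
  refine Θ.mem_graph_A hp ?_
  rw [Θ.lambda.domain_eq]
  refine ⟨LinearPMap.mem_domain_of_mem_graph hp, ?_⟩
  refine LinearPMap.mem_adjoint_domain_of_exists _ ⟨p.2, fun y => ?_⟩
  obtain ⟨g, hg1, hg2⟩ := Θ.exists_lift (Θ.T.mem_graph y)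
  have hf3 := Θ.S_apply f
  rw [hf, mul_zero, zero_smul ℂ (Θ.K 1), add_zero, hf2] at hf3
  have hg3 : Θ.S g f = biRe Θ.S g f := by
    rw [Θ.S_apply g]
    change biRe Θ.S g f + _ * Θ.K 1 f = _
    rw [← conj_channelAdjoint, hf]
    simp
  have h1 := biRe_symm Θ.S g f
  rw [← hf3, ← hg3, hg2, toMinus_apply, toMinus_apply, hf1, hg1, inner_conj_symm] at h1
  exact h1

/-- On `dom A` both `𝔸` and `𝔸*` act as `A`, so their difference `2i (K* f) K 1` vanishes, while `K
1 ≠ 0`. -/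
theorem channelAdjoint_eq_zero_of_mem_domain {f : HPlus Θ.A} (hf : incl Θ.A f ∈ Θ.A.domain) :
    channelAdjoint Θ.K f = 0 := by
  obtain ⟨g, hg1, hg2⟩ := Θ.starExtension.ext ⟨_, Θ.lambda.le.1 hf⟩
  obtain ⟨k, hk1, hk2⟩ := Θ.starExtension.ext_adjoint ⟨_, Θ.starExtension.le_adjoint.1 hf⟩
  have hg : g = f := incl_injective hg1
  have hk : k = f := incl_injective hk1
  subst hg
  subst hk
  rw [← Θ.starExtension.le_adjoint.2 (x := ⟨_, hf⟩) rfl] at hk2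
  rw [← Θ.lambda.le.2 (x := ⟨_, hf⟩) rfl] at hg2
  rw [← hg2, Θ.S_apply, Θ.biAdjoint_S_apply] at hk2
  have h1 : (2 * (Complex.I * channelAdjoint Θ.K k)) • Θ.K 1 = 0 := by
    rw [← sub_eq_zero.2 hk2.symm]
    module
  obtain ⟨-, -, g, -, -, hg⟩ := Θ.exists_channelAdjoint_eq_I
  have h2 : 2 * (Complex.I * channelAdjoint Θ.K k) * Θ.K 1 g = 0 := DFunLike.congr_fun h1 g
  rw [← conj_channelAdjoint, hg] at h2
  simpa using h2

theorem quasiKernel_selfAdjoint : IsSelfAdjoint (quasiKernel (biRe Θ.S)) :=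
  Θ.starExtension.re.quasiKernel_selfAdjoint

theorem graph_A_le_graph_quasiKernel : Θ.A.graph ≤ (quasiKernel (biRe Θ.S)).graph := by
  intro p hp
  obtain ⟨x, hx1, hx2⟩ := LinearPMap.mem_graph_iff _ |>.1 hp
  obtain ⟨f, hf1, hf2⟩ := Θ.starExtension.re.ext x
  exact (mem_graph_quasiKernel Θ.dense_range_incl).2 ⟨f, by rw [hf1, hx1], by rw [hf2, hx2]⟩

/-- The main operator is dissipative. -/
theorem im_inner_nonneg {p : H × H} (hp : p ∈ Θ.T.graph) : 0 ≤ (⟪p.1, p.2⟫_ℂ).im := by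
  obtain ⟨f, hf1, hf2⟩ := Θ.exists_lift hp
  have h1 := Θ.im_S_apply_self f
  rw [hf2, toMinus_apply, hf1] at h1
  rw [h1]
  positivity

/-- The open lower half-plane consists of regular points of the main operator. -/
theorem mem_resolventSet_of_im_neg {z : ℂ} (hz : z.im < 0) : z ∈ resolventSet Θ.T := by
  have hbound : ∀ p ∈ Θ.T.graph, |z.im| * ‖p.1‖ ≤ ‖subSmul H z p‖ := fun p hp =>
    abs_im_mul_norm_le_norm_sub_smul (y := p.2)
      (mul_nonpos_of_nonneg_of_nonpos (Θ.im_inner_nonneg hp) hz.le)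
  have hz' : 0 < |z.im| := abs_pos.2 hz.ne
  refine mem_resolventSet_of_bound hz' hbound ?_
  obtain ⟨w, hw, hTw⟩ := exists_nonreal_surjective Θ.lambda.resolvent_nonempty
  obtain ⟨p₀, hp₀, f₀, hf1, hf2, hf3⟩ := Θ.exists_channelAdjoint_eq_I
  refine exists_subSmul_eq_of_one_dim_extension Θ.graph_A_le_graph_T
    Θ.graph_A_le_graph_quasiKernel hp₀ ?_ ?_ hTw
    (exists_subSmul_eq_of_isSelfAdjoint Θ.quasiKernel_selfAdjoint hw)
    (fun p hp => eq_zero_of_subSmul_eq_zero_of_isSelfAdjoint Θ.quasiKernel_selfAdjoint hw hp)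
    (exists_subSmul_eq_of_isSelfAdjoint Θ.quasiKernel_selfAdjoint hz.ne) ?_
  · intro h
    have h1 := Θ.channelAdjoint_eq_zero_of_mem_domain
      (f := f₀) (by rw [hf1]; exact LinearPMap.mem_domain_of_mem_graph h)
    exact Complex.I_ne_zero (hf3.symm.trans h1)
  · intro p hp
    obtain ⟨f, hg1, hg2⟩ := Θ.exists_lift hp
    refine ⟨channelAdjoint Θ.K f / Complex.I, ?_⟩
    refine Θ.mem_graph_A_of_channelAdjoint_eq_zero (Θ.T.graph.sub_mem hp
      (Θ.T.graph.smul_mem _ hp₀)) (f := f - (channelAdjoint Θ.K f / Complex.I) • f₀) ?_ ?_ ?_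
    · rw [map_sub, map_smul, hf1, hg1, Prod.fst_sub, Prod.smul_fst]
    · rw [map_sub, map_smul, hf2, hg2, Prod.snd_sub, Prod.smul_snd, toMinus_sub, toMinus_smul]
    · rw [channelAdjoint_sub, channelAdjoint_smul, hf3, div_mul_cancel₀ _ Complex.I_ne_zero,
        sub_self]
  · intro p hp h
    have h1 := hbound p hp
    rw [h, norm_zero] at h1
    have h2 : p.1 = 0 := norm_le_zero_iff.1 (nonpos_of_mul_nonpos_right h1 hz')
    rw [subSmul_apply, h2, smul_zero, sub_zero] at h
    exact Prod.ext h2 h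

/-- The range of `Re 𝔸 - z` contains the range of the channel operator for nonreal `z`. -/
theorem exists_biRe_sub_eq_channel {z : ℂ} (hz : z.im ≠ 0) :
    ∃ x : HPlus Θ.A, biRe Θ.S x - z • toMinus Θ.A (incl Θ.A x) = Θ.K 1 := by
  -- The normalization `K* f = i` gives `Re 𝔸 f = 𝔸 f + K 1` with `𝔸 f` in `H`. The part of `(Re 𝔸 -
  -- z) f` in `H` is then removed by a vector `u` of the quasi-kernel.
  obtain ⟨p, -, f, hf1, hf2, hf3⟩ := Θ.exists_channelAdjoint_eq_I
  obtain ⟨q, hq, hqh⟩ := exists_subSmul_eq_of_isSelfAdjoint Θ.quasiKernel_selfAdjoint hz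
    (subSmul H z p)
  obtain ⟨u, hu1, hu2⟩ := (mem_graph_quasiKernel Θ.dense_range_incl).1 hq
  refine ⟨f - u, ?_⟩
  have h1 := Θ.S_apply f
  rw [hf2, hf3, Complex.I_mul_I] at h1
  have h2 := congrArg (toMinus Θ.A) hqh
  rw [subSmul_apply, subSmul_apply, toMinus_sub, toMinus_sub, toMinus_smul, toMinus_smul] at h2
  have h3 : biRe Θ.S f = toMinus Θ.A p.2 + Θ.K 1 := by rw [h1]; module
  rw [map_sub, map_sub, toMinus_sub, smul_sub, hf1, hu1, hu2, h3]
  have h4 := sub_eq_zero.2 h2.symm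
  rw [← sub_eq_zero, ← h4]
  abel

theorem impedance_spec {z : ℂ} (hz : z.im ≠ 0) :
    ∃ x : HPlus Θ.A, biRe Θ.S x - z • toMinus Θ.A (incl Θ.A x) = Θ.K 1 ∧
      Θ.impedance z = channelAdjoint Θ.K x :=
  ⟨_, biResolvent_spec (Θ.exists_biRe_sub_eq_channel hz), rfl⟩

/-- `Re 𝔸` is symmetric, so pairing a solution at `z` with one at `conj z` cancels the resolvent
terms. This replaces uniqueness of solutions below. -/
theorem channel_pairing_symm {x y : HPlus Θ.A} {z a b : ℂ}
    (hx : biRe Θ.S x - z • toMinus Θ.A (incl Θ.A x) = a • Θ.K 1)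
    (hy : biRe Θ.S y - conj z • toMinus Θ.A (incl Θ.A y) = b • Θ.K 1) :
    a * conj (channelAdjoint Θ.K y) = conj b * channelAdjoint Θ.K x := by
  have h1 : biRe Θ.S x y - z * ⟪incl Θ.A y, incl Θ.A x⟫_ℂ = a * Θ.K 1 y :=
    DFunLike.congr_fun hx y
  have h2 : biRe Θ.S y x - conj z * ⟪incl Θ.A x, incl Θ.A y⟫_ℂ = b * Θ.K 1 x :=
    DFunLike.congr_fun hy x
  have h3 := congrArg conj h2
  rw [map_sub, map_mul, map_mul, Complex.conj_conj, biRe_symm, inner_conj_symm, h1,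
    ← conj_channelAdjoint, ← conj_channelAdjoint, Complex.conj_conj] at h3
  exact h3

theorem impedance_conj {z : ℂ} (hz : z.im ≠ 0) :
    Θ.impedance (conj z) = conj (Θ.impedance z) := by
  obtain ⟨x, hx, hx'⟩ := Θ.impedance_spec hz
  obtain ⟨y, hy, hy'⟩ := Θ.impedance_spec (z := conj z) (by simpa using hz)
  have h := Θ.channel_pairing_symm (a := 1) (b := 1) (by rw [hx, one_smul]) (by rw [hy, one_smul])
  rw [map_one, one_mul, one_mul] at h
  rw [hx', hy', ← h, Complex.conj_conj]

/-- Pairing the resolvent equation with its own solution `x` gives `Im V(z) = Im z ‖x‖²`. -/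
theorem im_impedance_nonpos {z : ℂ} (hz : z.im < 0) : (Θ.impedance z).im ≤ 0 := by
  obtain ⟨x, hx, hx'⟩ := Θ.impedance_spec hz.ne
  have h1 : biRe Θ.S x x - z * ⟪incl Θ.A x, incl Θ.A x⟫_ℂ = Θ.K 1 x :=
    DFunLike.congr_fun hx x
  have h2 : (biRe Θ.S x x).im = 0 := Complex.conj_eq_iff_im.1 (biRe_symm Θ.S x x)
  have h3 := congrArg Complex.im h1
  rw [inner_self_eq_norm_sq_to_K, ← conj_channelAdjoint, ← hx', Complex.sub_im, h2,
    Complex.conj_im] at h3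
  simp [← Complex.ofReal_pow] at h3
  rw [← h3]
  exact mul_nonpos_of_nonpos_of_nonneg hz.le (by positivity)

theorem one_add_I_mul_impedance_ne_zero {z : ℂ} (hz : z.im < 0) :
    1 + Complex.I * Θ.impedance z ≠ 0 := by
  intro h
  have h1 := congrArg Complex.re h
  have h2 := Θ.im_impedance_nonpos hz
  simp at h1
  linarith

/-- The transfer function is the Cayley transform of the impedance function. -/
theorem transfer_mul {z : ℂ} (hz : z.im < 0) :
    Θ.transfer z * (1 + Complex.I * Θ.impedance z) = 1 - Complex.I * Θ.impedance z := by
  have hne := Θ.one_add_I_mul_impedance_ne_zero hz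
  have hex : ∃ x : HPlus Θ.A, Θ.S x - z • toMinus Θ.A (incl Θ.A x) = Θ.K 1 := by
    obtain ⟨x, hx, hx'⟩ := Θ.impedance_spec hz.ne
    -- Adding `i K K*` to `Re 𝔸` turns the right-hand side `K 1` into `(1 + iV) K 1`.
    refine ⟨(1 + Complex.I * Θ.impedance z)⁻¹ • x, ?_⟩
    set v := 1 + Complex.I * Θ.impedance z with hv
    have h1 : Θ.S x - z • toMinus Θ.A (incl Θ.A x) = v • Θ.K 1 := by
      rw [Θ.S_apply, add_sub_right_comm, hx, ← hx', hv]
      module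
    have h2 : Θ.S (v⁻¹ • x) - z • toMinus Θ.A (incl Θ.A (v⁻¹ • x)) =
        v⁻¹ • (Θ.S x - z • toMinus Θ.A (incl Θ.A x)) := by
      rw [map_smul, map_smul, toMinus_smul]
      module
    rw [h2, h1, smul_smul v⁻¹ v (Θ.K 1), inv_mul_cancel₀ hne, one_smul ℂ (Θ.K 1)]
  have hx := biResolvent_spec hex
  set x := biResolvent Θ.S z (Θ.K 1) with hxdef
  set k := channelAdjoint Θ.K x with hk
  have htr : Θ.transfer z = 1 - 2 * Complex.I * k := rfl
  have hx2 : biRe Θ.S x - z • toMinus Θ.A (incl Θ.A x) = (1 - Complex.I * k) • Θ.K 1 := by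
    rw [Θ.S_apply x, ← hk, add_sub_right_comm] at hx
    rw [sub_smul 1 (Complex.I * k) (Θ.K 1), one_smul ℂ (Θ.K 1), eq_sub_iff_add_eq, hx]
  obtain ⟨y, hy, hy'⟩ := Θ.impedance_spec (z := conj z) (by simpa using hz.ne)
  -- The result is `(1 - ik) V(z) = k`, whichever solution `biResolvent` selects.
  have h := Θ.channel_pairing_symm (b := 1) hx2 (by rw [hy, one_smul])
  rw [map_one, one_mul, ← hy', Θ.impedance_conj hz.ne, Complex.conj_conj, ← hk] at h
  rw [htr]
  linear_combination (2 * Complex.I) * h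

end LSystem

/-! ### Rotation of the impedance and the main theorem. -/

/-- A unimodular transformation rotates the impedance function. -/
theorem IsUnimodularTransformation.impedance_mul {H : Type*} [NormedAddCommGroup H]
    [InnerProductSpace ℂ H] [CompleteSpace H] {H' : Type*} [NormedAddCommGroup H']
    [InnerProductSpace ℂ H'] [CompleteSpace H'] {Θ : LSystem H} {Θ' : LSystem H'} {α : ℝ}
    (h : IsUnimodularTransformation Θ Θ' α) {z : ℂ} (hz : 0 < z.im) :
    Θ'.impedance z * (Real.sin α - Real.cos α * Θ.impedance z) =
      Real.cos α + Real.sin α * Θ.impedance z := by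
  have hz' : (conj z).im < 0 := by simpa using hz
  have h1 := h.2 _ ⟨Θ.mem_resolventSet_of_im_neg hz', Θ'.mem_resolventSet_of_im_neg hz'⟩
  have h2 := Θ.transfer_mul hz'
  have h3 := Θ'.transfer_mul hz'
  have hexp : Complex.exp (2 * Complex.I * α) =
      (Real.cos α + Real.sin α * Complex.I) * (Real.cos α + Real.sin α * Complex.I) := by
    rw [Complex.ofReal_cos, Complex.ofReal_sin, ← Complex.exp_mul_I, ← Complex.exp_add]
    ring_nf
  rw [h1, hexp] at h3
  have hcs : (Real.sin α : ℂ) ^ 2 + (Real.cos α : ℂ) ^ 2 = 1 := by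
    exact_mod_cast Real.sin_sq_add_cos_sq α
  -- The identity is proved at `conj z`, a regular point of both main operators, and then
  -- conjugated.
  have key : Θ'.impedance (conj z) * (Real.sin α - Real.cos α * Θ.impedance (conj z)) =
      Real.cos α + Real.sin α * Θ.impedance (conj z) := by
    generalize Θ.transfer (conj z) = t at *
    generalize Θ.impedance (conj z) = V at *
    generalize Θ'.impedance (conj z) = V' at *
    generalize (Real.cos α : ℂ) = c at *
    generalize (Real.sin α : ℂ) = s at *
    have hI := Complex.I_sq
    generalize Complex.I = I at *
    -- Multiplication by `e^{-iα}` cancels one of the two factors `e^{iα}`, leaving an identity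
    -- linear in `c` and `s`.
    have hcs' : (c - s * I) * (c + s * I) = 1 := by linear_combination hcs - s ^ 2 * hI
    have hE : (1 - I * V) * -((c + s * I) * (c + s * I)) * (1 + I * V') -
        (1 - I * V') * (1 + I * V) = 0 := by
      linear_combination (1 + I * V) * h3 + (c + s * I) * (c + s * I) * (1 + I * V') * h2
    linear_combination (1 / 2 : ℂ) * ((c - s * I) * hE +
      (1 - I * V) * (c + s * I) * (1 + I * V') * hcs' +
      (2 * s * V' - 2 * c * V * V' - 2 * s * V) * hI)
  have hc := congrArg conj key
  rw [Θ.impedance_conj hz.ne', Θ'.impedance_conj hz.ne'] at hc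
  simpa only [map_mul, map_sub, map_add, Complex.conj_conj, Complex.conj_ofReal] using hc

end LSys

theorem theorem5p4
    {H : Type*} [NormedAddCommGroup H] [InnerProductSpace ℂ H] [CompleteSpace H]
    {H' : Type*} [NormedAddCommGroup H'] [InnerProductSpace ℂ H'] [CompleteSpace H']
    (κ : ℝ) (hκ₀ : 0 ≤ κ) (hκ₁ : κ < 1) (Q : ℝ) (hQ : Q ≠ 0)
    (α : ℝ) (hα : α ≠ Real.pi / 2)
    (Θ : LSys.LSystem H) (Θα : LSys.LSystem H')
    (hV : LSys.DonoghueClass κ Q Θ.impedance)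
    (hΘα : LSys.IsUnimodularTransformation Θ Θα α)
    (a b : ℝ) (ha : a = (1 - κ) / (1 + κ)) (hb : b = Q ^ 2 + a ^ 2 - 1) :
    LSys.DonoghueClass κ (-Q) Θα.impedance ↔ Real.tan α = b / (2 * Q) := by
  have hcos : Real.cos α ≠ 0 := by
    intro h
    refine hα (Real.injOn_cos ⟨hΘα.1.1, hΘα.1.2.le⟩ ⟨by positivity, ?_⟩ ?_)
    · linarith [Real.pi_pos]
    · rw [h, Real.cos_pi_div_two]
  rw [hV.neg_iff_of_moebius hκ₀ hκ₁ hcos (Real.sin_sq_add_cos_sq α)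
    fun z hz => hΘα.impedance_mul hz, hb, ha, Real.tan_eq_sin_div_cos,
    div_eq_div_iff hcos (mul_ne_zero two_ne_zero hQ)]
  constructor <;> intro h <;> linarith
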